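/- Let $F$ be a field. A *finite filtered complex* $C$ over $F$ consists of a finite set of cells, each cell $c$ with a dimension $\dim c\in\mathbb{N}$ and a filtration value $g(c)\in\mathbb{Z}$, and incidence coefficients $\kappa(A,b)\in F$ such that $\kappa(A,b)\neq 0$ (then $b$ is called a face of $A$) implies $\dim A=\dim b+1$ and $g(b)\le g(A)$, and such that $\partial A=\sum_b\kappa(A,b)\,b$ satisfies $\partial\partial=0$. Write $C_t$ for the subcomplex of the cells with $g\le t$, where $t\in\mathbb{Z}\cup\{\infty\}$ and $C_\infty=C$. With $\beta_p^{s,t}=\operatorname{rank}\bigl(H_p(C_s)\to H_p(C_t)\bigr)$, the persistence intervals of $C$ in dimension $p$ form the multiset in which, for integers $i<j$, the interval $[i,j]$ has multiplicity $(\beta_p^{i,j-1}-\beta_p^{i,j})-(\beta_p^{i-1,j-1}-\beta_p^{i-1,j})$ and $[i,\infty]$ has multiplicity $\beta_p^{i,\infty}-\beta_p^{i-1,\infty}$. A *Morse matching* $m$ on $C$ is a set of pairs $(A,b)$, $b$ a face of $A$, such that no cell lies in two pairs and the *Morse graph* (edges $A\to b$ for each face $b$ of $A$ with $(A,b)\notin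 m$, and $b\to A$ for $(A,b)\in m$) has no directed cycle. Its *Morse complex* has the unmatched cells as cells, with the same dimensions and filtration values; the incidence coefficient of $s$ with $t$, where $\dim s=\dim t+1$, is the sum over all directed paths from $s$ to $t$ in the Morse graph of the product of the edge weights, an edge $A\to b$ having weight $\kappa(A,b)$ and a reversed edge $b\to A$ weight $-\kappa(A,b)^{-1}$ (for $F=\mathbb{Z}_2$: the parity of the number of paths). The matching is *compatible with the filtration* if $g(A)=g(b)$ for all its pairs. A strategy, that is, a rule choosing on each filtered complex a matching of a prescribed kind, is *vital* if it makes at least one match whenever a nonempty matching of that kind exists. Let $\mathcal{K}$ be a finite filtered complex over $F$, and fix a vital strategy that chooses matchings compatible with the filtration. Let $\mathbb{M}(C)$ be the Morse complex of the matching chosen on $C$, and let $\mathbb{M}^\infty(\mathcal{K})$ be the fixed point of the iteration $\mathcal{K},\mathbb{M}(\mathcal{K}),\mathbb{M}^2(\mathcal{K}),\dots$. Fix also a strategy that, given a filtered complex $C$ and $i\in\mathbb{Z}$, chooses a Morse matching on $C_i$ (matches between different filtration values are allowed) such that in each chosen pair $(A,b)$ the value $g(b)$ is largest among all faces of $A$,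 and such that at least one match is made whenever $C_i$ has a nonempty Morse matching. Run the following algorithm. 1. Put $C:=\mathbb{M}^\infty(\mathcal{K})$, and let $S$ be the empty multiset. 2. For each filtration level $i$ (value of $g$) of $\mathbb{M}^\infty(\mathcal{K})$, in increasing order from the second to the last: as long as the strategy matches something on $C_i$, add to $S$ the interval $[g(b),g(A)]$, in dimension $\dim b$, for every chosen pair $(A,b)$, and replace $C$ by the Morse complex of the whole of $C$ for the chosen matching. 3. For every cell $c$ of the final $C$ add to $S$ the interval $[g(c),\infty]$, in dimension $\dim c$. Return $S$. Then the fixed point $\mathbb{M}^\infty(\mathcal{K})$ is reached after finitely many steps, the algorithm terminates, and the multiset $S$ it returns is exactly the multiset of persistence intervals of $\mathcal{K}$ (in every dimension). -/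

import Mathlib

set_option maxSynthPendingDepth 3

/-- The data of a finite filtered complex with coefficients in `F`: a finite set `cells` of
cells (named by elements of `α`), a dimension `dim c` and a filtration value `g c` of each cell,
and the incidence coefficients, `κ A b` being the coefficient of `b` in the boundary of `A`.
The laws of a filtered chain complex are in `CellData.IsFilteredComplex`. -/
@[ext]
structure CellData (F : Type*) (α : Type*) where
  cells : Finset α
  dim : α → ℕ
  g : α → ℤ
  κ : α → α → F

namespace CellData

universe u v

variable {F : Type u} [Field F] {α : Type v}

/-- The laws of a filtered chain complex: incidences are between cells of consecutive dimensions,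
a face never enters the filtration after its coface, and `∂ ∘ ∂ = 0`. -/
structure IsFilteredComplex (C : CellData F α) : Prop where
  mem_left : ∀ A b, C.κ A b ≠ 0 → A ∈ C.cells
  mem_right : ∀ A b, C.κ A b ≠ 0 → b ∈ C.cells
  dim_eq : ∀ A b, C.κ A b ≠ 0 → C.dim A = C.dim b + 1
  g_le : ∀ A b, C.κ A b ≠ 0 → C.g b ≤ C.g A
  boundary_boundary : ∀ A c, ∑ b ∈ C.cells, C.κ A b * C.κ b c = 0

/-- The sublevel complex `g ≤ i`. -/
def sublevel (C : CellData F α) (i : ℤ) : CellData F α where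
  cells := C.cells.filter (fun c => C.g c ≤ i)
  dim := C.dim
  g := C.g
  κ A b := if C.g A ≤ i ∧ C.g b ≤ i then C.κ A b else 0

/-! ### Persistent homology -/

section Homology

/-- The boundary operator on (all) chains. -/
noncomputable def boundary (C : CellData F α) : (α →₀ F) →ₗ[F] (α →₀ F) :=
  Finsupp.linearCombination F (fun A => ∑ b ∈ C.cells, Finsupp.single b (C.κ A b))

/-- The `p`-chains of the sublevel complex `g ≤ t`; for `t = ⊤` those of the whole complex. -/
def chains (C : CellData F α) (p : ℕ) (t : WithTop ℤ) : Submodule F (α →₀ F) :=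
  Finsupp.supported F F {c | c ∈ C.cells ∧ C.dim c = p ∧ (C.g c : WithTop ℤ) ≤ t}

/-- The `p`-cycles of the sublevel complex `g ≤ t`. -/
noncomputable def cycles (C : CellData F α) (p : ℕ) (t : WithTop ℤ) : Submodule F (α →₀ F) :=
  C.chains p t ⊓ LinearMap.ker C.boundary

/-- The `p`-boundaries of the sublevel complex `g ≤ t`. -/
noncomputable def boundaries (C : CellData F α) (p : ℕ) (t : WithTop ℤ) : Submodule F (α →₀ F) :=
  (C.chains (p + 1) t).map C.boundary

/-- The `p`-th homology (cycles modulo boundaries) of the sublevel complex `g ≤ t`. -/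
abbrev homology (C : CellData F α) (p : ℕ) (t : WithTop ℤ) : Type (max u v) :=
  C.cycles p t ⧸ (C.boundaries p t).submoduleOf (C.cycles p t)

theorem chains_mono (C : CellData F α) (p : ℕ) {s t : WithTop ℤ} (h : s ≤ t) :
    C.chains p s ≤ C.chains p t :=
  Finsupp.supported_mono fun _ hc => ⟨hc.1, hc.2.1, hc.2.2.trans h⟩

theorem cycles_mono (C : CellData F α) (p : ℕ) {s t : WithTop ℤ} (h : s ≤ t) :
    C.cycles p s ≤ C.cycles p t :=
  inf_le_inf_right _ (C.chains_mono p h)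

/-- The map induced on homology by the inclusion of sublevel complexes. -/
noncomputable def homologyMap (C : CellData F α) (p : ℕ) {s t : WithTop ℤ} (h : s ≤ t) :
    C.homology p s →ₗ[F] C.homology p t :=
  Submodule.mapQ _ _ (Submodule.inclusion (C.cycles_mono p h))
    (fun _ hx => Submodule.map_mono (C.chains_mono (p + 1) h) hx)

/-- The persistent Betti number: the rank of `H_p(g ≤ s) → H_p(g ≤ t)` (used for `s ≤ t` only). -/
noncomputable def persistentBetti (C : CellData F α) (p : ℕ) (s t : WithTop ℤ) : ℤ :=
  if h : s ≤ t then (Module.finrank F (LinearMap.range (C.homologyMap p h)) : ℤ) else 0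

/-- The multiplicity of the `p`-dimensional persistence interval with birth `b` and death `d`
(`d = ⊤` for a class that never dies): the number of independent `p`-dimensional classes that are
born at `b` and die entering `d`. There are no intervals with `d ≤ b`. -/
noncomputable def multiplicity (C : CellData F α) (p : ℕ) (b : ℤ) : WithTop ℤ → ℤ
  | ⊤ => C.persistentBetti p b ⊤ - C.persistentBetti p ((b - 1 : ℤ) : WithTop ℤ) ⊤
  | (d : ℤ) =>
    if b < d then
      (C.persistentBetti p b ((d - 1 : ℤ) : WithTop ℤ) - C.persistentBetti p b (d : WithTop ℤ)) -
        (C.persistentBetti p ((b - 1 : ℤ) : WithTop ℤ) ((d - 1 : ℤ) : WithTop ℤ) -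
          C.persistentBetti p ((b - 1 : ℤ) : WithTop ℤ) (d : WithTop ℤ))
    else 0

/-- `S` is the multiset of persistence intervals of `C`; an interval is recorded as
`(dimension, birth, death)`. -/
def IsPersistenceIntervals (C : CellData F α) (S : Multiset (ℕ × ℤ × WithTop ℤ)) : Prop :=
  ∀ (p : ℕ) (b : ℤ) (d : WithTop ℤ), (S.count (p, b, d) : ℤ) = C.multiplicity p b d

end Homology

/-! ### Morse matchings and Morse complexes -/

section Morse

variable [DecidableEq α]

/-- The edges of the Morse graph of a matching `m` (a set of pairs `(A, b)` with `b` a face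
of `A`): from a cell to each of its faces that is not matched with it, and from `b` to `A` if
`(A, b)` is matched. -/
def MorseEdge (C : CellData F α) (m : Finset (α × α)) (u v : α) : Prop :=
  (C.κ u v ≠ 0 ∧ (u, v) ∉ m) ∨ (v, u) ∈ m

/-- `m` is an acyclic Morse matching on `C`: every pair `(A, b)` consists of a cell and a face of
it, no cell lies in two pairs, and the Morse graph has no directed cycle. -/
structure IsMorseMatching (C : CellData F α) (m : Finset (α × α)) : Prop where
  mem : ∀ q ∈ m, q.1 ∈ C.cells ∧ q.2 ∈ C.cells
  face : ∀ q ∈ m, C.κ q.1 q.2 ≠ 0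
  disjoint : ∀ q ∈ m, ∀ r ∈ m, (q.1 = r.1 ∨ q.2 = r.2 ∨ q.1 = r.2) → q = r
  acyclic : ∀ c, ¬ Relation.TransGen (C.MorseEdge m) c c

/-- The critical (unmatched) cells. -/
def critical (C : CellData F α) (m : Finset (α × α)) : Finset α :=
  C.cells.filter (fun c => c ∉ m.image Prod.fst ∧ c ∉ m.image Prod.snd)

/-- The weight of an edge of the Morse graph: `κ u v` for an edge from a cell to a face, and
`-1 / κ A b` for the reversed edge from `b` to `A`; zero if there is no edge from `u` to `v`.
For `F = ZMod 2` every edge has weight `1`. -/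
def edgeWeight (C : CellData F α) (m : Finset (α × α)) (u v : α) : F :=
  if (v, u) ∈ m then -(C.κ v u)⁻¹ else if (u, v) ∈ m then 0 else C.κ u v

/-- The sum, over all paths with `n` edges from `s` to `t` in the Morse graph, of the product of
the weights of the edges. For `F = ZMod 2` it is the number of such paths modulo `2`. -/
def pathWeight (C : CellData F α) (m : Finset (α × α)) : ℕ → α → α → F
  | 0, s, t => if s = t then 1 else 0
  | n + 1, s, t => ∑ v ∈ C.cells, C.edgeWeight m s v * pathWeight C m n v t

/-- The Morse complex of a matching `m`: its cells are the critical cells, with inherited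
dimensions and filtration values; the incidence of `s` with `t` (of dimension one less) is the
weighted number of all paths from `s` to `t` in the Morse graph. As that graph is acyclic, a path
has fewer edges than there are cells. -/
def morseComplex (C : CellData F α) (m : Finset (α × α)) : CellData F α where
  cells := C.critical m
  dim := C.dim
  g := C.g
  κ s t :=
    if s ∈ C.critical m ∧ t ∈ C.critical m ∧ C.dim s = C.dim t + 1 then
      ∑ n ∈ Finset.range C.cells.card, C.pathWeight m n s t
    else 0

/-- A matching is compatible with the filtration if matched cells have equal filtration value. -/
def IsCompatible (C : CellData F α) (m : Finset (α × α)) : Prop :=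
  ∀ q ∈ m, C.g q.1 = C.g q.2

end Morse

/-! ### The iterated Morse complex of a filtered complex -/

section Iterated

variable [DecidableEq α]

/-- `σ` chooses, on every filtered complex, an acyclic Morse matching compatible with the
filtration, and it is vital: if there is a nonempty such matching, it makes at least one match. -/
structure IsVitalCompatibleStrategy (σ : CellData F α → Finset (α × α)) : Prop where
  isMorseMatching : ∀ C : CellData F α, C.IsFilteredComplex → C.IsMorseMatching (σ C)
  isCompatible : ∀ C : CellData F α, C.IsFilteredComplex → C.IsCompatible (σ C)
  vital : ∀ C : CellData F α, C.IsFilteredComplex →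
    (∃ m, C.IsMorseMatching m ∧ C.IsCompatible m ∧ m.Nonempty) → (σ C).Nonempty

/-- `C` is the iterated Morse complex of `K` for the strategy `σ`: the fixed point reached by
the iteration `K, 𝕄 K, 𝕄 (𝕄 K), …`, where `𝕄 C` is the Morse complex of `C` for `σ C`. -/
def IsIteratedMorseComplex (σ : CellData F α → Finset (α × α)) (K C : CellData F α) : Prop :=
  (∃ n : ℕ, C = (fun D : CellData F α => D.morseComplex (σ D))^[n] K) ∧
    Function.IsFixedPt (fun D : CellData F α => D.morseComplex (σ D)) C

end Iterated

/-! ### Persistence intervals by Morse matchings across levels -/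

section Algorithm

variable [DecidableEq α]

/-- In every pair `(A, b)` of `m`, the cell `b` has the largest filtration value among all
faces of `A`. -/
def IsMaximal (C : CellData F α) (m : Finset (α × α)) : Prop :=
  ∀ q ∈ m, ∀ b, C.κ q.1 b ≠ 0 → C.g b ≤ C.g q.2

/-- `τ` chooses, on every sublevel complex `g ≤ i` of every filtered complex `C`, an acyclic
Morse matching (matches between different filtration values being allowed) in which each matched
cell is matched with a face of largest filtration value; and it is vital: if there is a nonempty
acyclic Morse matching on the sublevel complex, it makes at least one match. -/
structure IsVitalMaximalStrategy (τ : CellData F α → ℤ → Finset (α × α)) : Prop where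
  isMorseMatching : ∀ C : CellData F α, C.IsFilteredComplex → ∀ i,
    (C.sublevel i).IsMorseMatching (τ C i)
  isMaximal : ∀ C : CellData F α, C.IsFilteredComplex → ∀ i, (C.sublevel i).IsMaximal (τ C i)
  vital : ∀ C : CellData F α, C.IsFilteredComplex → ∀ i,
    (∃ m, (C.sublevel i).IsMorseMatching m ∧ m.Nonempty) → (τ C i).Nonempty

/-- The intervals `[g b, g A]`, in the dimension of `b`, of the matched pairs `(A, b)`. -/
def matchedIntervals (C : CellData F α) (m : Finset (α × α)) : Multiset (ℕ × ℤ × WithTop ℤ) :=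
  m.val.map (fun q => (C.dim q.2, C.g q.2, (C.g q.1 : WithTop ℤ)))

/-- The intervals `[g c, ∞]`, in the dimension of `c`, of all cells `c`. -/
def infiniteIntervals (C : CellData F α) : Multiset (ℕ × ℤ × WithTop ℤ) :=
  C.cells.val.map (fun c => (C.dim c, C.g c, (⊤ : WithTop ℤ)))

/-- The inner loop at level `i`: `WhileLoop τ i C S C' S'` says that, started with the
complex `C` and the multiset `S`, it stops with `C'` and `S'`. It matches on the sublevel complex
`g ≤ i` until nothing is matched; the Morse complex is always that of the whole complex. -/
inductive WhileLoop (τ : CellData F α → ℤ → Finset (α × α)) (i : ℤ) :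
    CellData F α → Multiset (ℕ × ℤ × WithTop ℤ) →
    CellData F α → Multiset (ℕ × ℤ × WithTop ℤ) → Prop
  | done (C : CellData F α) (S : Multiset (ℕ × ℤ × WithTop ℤ)) (h : τ C i = ∅) :
      WhileLoop τ i C S C S
  | step (C C' : CellData F α) (S S' : Multiset (ℕ × ℤ × WithTop ℤ)) (h : τ C i ≠ ∅)
      (hrest : WhileLoop τ i (C.morseComplex (τ C i)) (S + C.matchedIntervals (τ C i)) C' S') :
      WhileLoop τ i C S C' S'

/-- The outer loop, over a list of levels. -/
inductive ForLoop (τ : CellData F α → ℤ → Finset (α × α)) :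
    List ℤ → CellData F α → Multiset (ℕ × ℤ × WithTop ℤ) →
    CellData F α → Multiset (ℕ × ℤ × WithTop ℤ) → Prop
  | nil (C : CellData F α) (S : Multiset (ℕ × ℤ × WithTop ℤ)) : ForLoop τ [] C S C S
  | cons (i : ℤ) (L : List ℤ) (C C' C'' : CellData F α)
      (S S' S'' : Multiset (ℕ × ℤ × WithTop ℤ))
      (hi : WhileLoop τ i C S C' S') (hL : ForLoop τ L C' S' C'' S'') :
      ForLoop τ (i :: L) C S C'' S''

/-- The filtration levels of `C`, in increasing order. -/
def levels (C : CellData F α) : List ℤ := (C.cells.image C.g).sort (· ≤ ·)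

/-- The algorithm with strategy `τ`, run on `C`, stops and returns `S`: it goes through the
levels from the second to the last, and then adds an infinite interval for each cell left. -/
def Returns (τ : CellData F α → ℤ → Finset (α × α)) (C : CellData F α)
    (S : Multiset (ℕ × ℤ × WithTop ℤ)) : Prop :=
  ∃ (C' : CellData F α) (S' : Multiset (ℕ × ℤ × WithTop ℤ)),
    ForLoop τ C.levels.tail C 0 C' S' ∧ S = S' + C'.infiniteIntervals

end Algorithm

end CellData

set_option linter.unusedSectionVars false

namespace CellData

universe u v

variable {F : Type u} [Field F] {α : Type v}

/-! ### The boundary operator in coordinates -/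

/-! The persistence intervals can be read off a standard basis: a basis of the chains, adapted to
dimension and filtration, in which the boundary operator sends the first vector of each pair to the
second and kills all other vectors. Cycles and boundaries of every sublevel complex are then spanned
by basis vectors, so persistent Betti numbers count cells and pairs (`persistentBetti_eq_sum`), and
the differences in `multiplicity` isolate the nondegenerate pairs and the unpaired cells
(`IsStandardBasis.isPersistenceIntervals`).

The run of the algorithm, read backwards, constructs such a basis. The final complex has zero
boundary, so its cells form one without pairs. A standard basis of a Morse complex extends to the
original complex (`IsStandardBasis.extendBasis`): critical cells are represented by their lifts
along gradient paths, and each matched pair `(A, b)` contributes the vectors `A` and `∂A`. The lifts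
span a subcomplex isomorphic to the Morse complex (`boundary_lift`). Two conditions make this
respect the filtration: `IsEarliest` keeps gradient paths from raising the filtration value, and
`IsMaximal` places `∂A` at the level of `b`. Both are automatic for compatible matchings, whose
pairs give only degenerate intervals.

In the algorithm `IsMaximal` is imposed, and `IsEarliest` follows from the invariant `IsReduced`:
while level `i` is processed, cells below level `i` have zero boundary. This holds because a single
incidence is already an acyclic matching, so a vital strategy stops only when no incidence is left,
and because passing to a Morse complex gives no boundary to a cell that had none. At the fixed point
all incidences strictly lower the filtration value, for the same reason; hence the intervals
recorded later are nondegenerate. Every nonempty matching removes cells, which gives termination. -/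

theorem boundary_single (C : CellData F α) (A : α) (a : F) :
    C.boundary (Finsupp.single A a) = ∑ b ∈ C.cells, Finsupp.single b (a * C.κ A b) := by
  simp [boundary, Finset.smul_sum]

namespace IsFilteredComplex

variable {C : CellData F α} (hC : C.IsFilteredComplex)

include hC

theorem boundary_apply (x : α →₀ F) (t : α) :
    C.boundary x t = ∑ v ∈ C.cells, x v * C.κ v t := by
  classical
  induction x using Finsupp.induction_linear with
  | zero => simp
  | add x y hx hy => simp [hx, hy, add_mul, Finset.sum_add_distrib]
  | single A a =>
    have h1 : C.boundary (Finsupp.single A a) t = a * C.κ A t := by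
      rw [boundary_single, Finsupp.finsetSum_apply]
      simp only [Finsupp.single_apply, Finset.sum_ite_eq']
      split_ifs with ht
      · rfl
      · by_contra h
        exact ht (hC.mem_right A t fun h0 => h (by simp [h0]))
    rw [h1]
    simp only [Finsupp.single_apply, ite_mul, zero_mul, Finset.sum_ite_eq]
    split_ifs with hA
    · rfl
    · by_contra h
      exact hA (hC.mem_left A t fun h0 => h (by simp [h0]))

theorem boundary_boundary_apply (x : α →₀ F) : C.boundary (C.boundary x) = 0 := by
  ext t
  rw [hC.boundary_apply]
  simp only [hC.boundary_apply x, Finset.sum_mul, Finsupp.coe_zero, Pi.zero_apply]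
  rw [Finset.sum_comm]
  refine Finset.sum_eq_zero fun v _ => ?_
  simp only [mul_assoc, ← Finset.mul_sum, hC.boundary_boundary v t, mul_zero]

theorem exists_of_boundary_apply_ne_zero {x : α →₀ F} {t : α} (h : C.boundary x t ≠ 0) :
    ∃ v ∈ C.cells, x v ≠ 0 ∧ C.κ v t ≠ 0 := by
  rw [hC.boundary_apply] at h
  obtain ⟨v, hv, hne⟩ := Finset.exists_ne_zero_of_sum_ne_zero h
  exact ⟨v, hv, left_ne_zero_of_mul hne, right_ne_zero_of_mul hne⟩

end IsFilteredComplex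

theorem mem_chains {C : CellData F α} {p : ℕ} {t : WithTop ℤ} {x : α →₀ F} :
    x ∈ C.chains p t ↔ ∀ c, x c ≠ 0 → c ∈ C.cells ∧ C.dim c = p ∧ (C.g c : WithTop ℤ) ≤ t := by
  simp only [chains, Finsupp.mem_supported, Set.subset_def, Finset.mem_coe, Finsupp.mem_support_iff,
    Set.mem_ofPred_eq]

/-! ### The Morse graph -/

section MorseGraph

variable [DecidableEq α] {C : CellData F α} {m : Finset (α × α)}

theorem morseEdge_of_edgeWeight_ne_zero {u v : α} (h : C.edgeWeight m u v ≠ 0) :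
    C.MorseEdge m u v := by
  unfold edgeWeight at h
  split_ifs at h with h1 h2
  · exact Or.inr h1
  · exact absurd rfl h
  · exact Or.inl ⟨h, h2⟩

theorem mem_critical {c : α} :
    c ∈ C.critical m ↔ c ∈ C.cells ∧ (∀ q ∈ m, q.1 ≠ c) ∧ ∀ q ∈ m, q.2 ≠ c := by
  simp only [critical, Finset.mem_filter, Finset.mem_image, not_exists, not_and, ne_eq]

theorem edgeWeight_critical {t : α} (ht : t ∈ C.critical m) (v : α) :
    C.edgeWeight m v t = C.κ v t := by
  obtain ⟨-, h1, h2⟩ := mem_critical.1 ht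
  rw [edgeWeight, if_neg fun h => h1 _ h rfl, if_neg fun h => h2 _ h rfl]

theorem edgeWeight_critical_left {s : α} (hs : s ∈ C.critical m) (v : α) :
    C.edgeWeight m s v = C.κ s v := by
  obtain ⟨-, h1, h2⟩ := mem_critical.1 hs
  rw [edgeWeight, if_neg fun h => h2 _ h rfl, if_neg fun h => h1 _ h rfl]

namespace IsMorseMatching

variable (hC : C.IsFilteredComplex) (hm : C.IsMorseMatching m)

include hC hm

theorem edge_mem {u v : α} (h : C.MorseEdge m u v) : u ∈ C.cells ∧ v ∈ C.cells := by
  rcases h with ⟨h, -⟩ | h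
  · exact ⟨hC.mem_left _ _ h, hC.mem_right _ _ h⟩
  · exact ⟨(hm.mem _ h).2, (hm.mem _ h).1⟩

theorem fst_ne_snd {q r : α × α} (hq : q ∈ m) (hr : r ∈ m) : q.1 ≠ r.2 := by
  intro h
  obtain rfl := hm.disjoint q hq r hr (Or.inr (Or.inr h))
  have := hC.dim_eq _ _ (hm.face q hq)
  rw [h] at this
  omega

theorem edgeWeight_snd {q : α × α} (hq : q ∈ m) (v : α) :
    C.edgeWeight m v q.2 = if v = q.1 then 0 else C.κ v q.2 := by
  rw [edgeWeight, if_neg fun h => fst_ne_snd hC hm h hq rfl]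
  refine if_congr ⟨fun h => ?_, fun h => ?_⟩ rfl rfl
  · exact congrArg Prod.fst (hm.disjoint _ h q hq (Or.inr (Or.inl rfl)))
  · rw [h]; exact hq

theorem edgeWeight_fst {q : α × α} (hq : q ∈ m) (v : α) :
    C.edgeWeight m v q.1 = if v = q.2 then -(C.κ q.1 q.2)⁻¹ else C.κ v q.1 := by
  rw [edgeWeight]
  have h1 : (q.1, v) ∈ m ↔ v = q.2 := by
    refine ⟨fun h => ?_, fun h => ?_⟩
    · exact congrArg Prod.snd (hm.disjoint _ h q hq (Or.inl rfl))
    · rw [h]; exact hq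
  have h2 : (v, q.1) ∉ m := fun h => fst_ne_snd hC hm hq h rfl
  simp only [h1, if_neg h2]
  split_ifs with h
  · rw [h]
  · rfl

end IsMorseMatching

open Classical in
/-- The number of cells that can be reached from `u` along nonempty paths in the Morse graph. -/
noncomputable def morseRank (C : CellData F α) (m : Finset (α × α)) (u : α) : ℕ :=
  (C.cells.filter fun v => Relation.TransGen (C.MorseEdge m) u v).card

section Rank

variable (hC : C.IsFilteredComplex) (hm : C.IsMorseMatching m)

include hC hm

/-- Everything reachable from `v` is reachable from `u`, and so is `v` itself, which by acyclicity
is not reachable from `v`. The rank thus serves as a height function on the Morse graph. -/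
theorem morseRank_lt {u v : α} (h : C.MorseEdge m u v) : C.morseRank m v < C.morseRank m u := by
  classical
  refine Finset.card_lt_card ⟨fun w hw => ?_, fun hsub => ?_⟩
  · simp only [Finset.mem_filter] at hw ⊢
    exact ⟨hw.1, Relation.TransGen.head h hw.2⟩
  · have : v ∈ C.cells.filter fun w => Relation.TransGen (C.MorseEdge m) v w :=
      hsub (Finset.mem_filter.2 ⟨(IsMorseMatching.edge_mem hC hm h).2, .single h⟩)
    exact hm.acyclic v (Finset.mem_filter.1 this).2

omit hC in
theorem morseRank_lt_card {u : α} (hu : u ∈ C.cells) : C.morseRank m u < C.cells.card := by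
  classical
  refine Finset.card_lt_card ⟨Finset.filter_subset _ _, fun hsub => ?_⟩
  exact hm.acyclic u (Finset.mem_filter.1 (hsub hu)).2

/-- Each edge of a path lowers the rank. With `morseRank_lt_card` this shows that cutting the path
sum off at the number of cells loses nothing. -/
theorem le_morseRank_of_pathWeight_ne_zero {n : ℕ} {s t : α} (h : C.pathWeight m n s t ≠ 0) :
    n ≤ C.morseRank m s := by
  induction n generalizing s with
  | zero => exact Nat.zero_le _
  | succ n ih =>
    obtain ⟨v, -, hv⟩ := Finset.exists_ne_zero_of_sum_ne_zero h
    have h1 := ih (right_ne_zero_of_mul hv)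
    have h2 := morseRank_lt hC hm (morseEdge_of_edgeWeight_ne_zero (left_ne_zero_of_mul hv))
    omega

/-- The definition splits off the first edge of a path; computing boundaries of lifts requires
splitting off the last. -/
theorem pathWeight_succ_right (n : ℕ) {s : α} (hs : s ∈ C.cells) (t : α) :
    C.pathWeight m (n + 1) s t = ∑ v ∈ C.cells, C.pathWeight m n s v * C.edgeWeight m v t := by
  induction n generalizing s with
  | zero =>
    simp only [pathWeight, mul_ite, mul_one, mul_zero, ite_mul, one_mul, zero_mul,
      Finset.sum_ite_eq, Finset.sum_ite_eq', if_pos hs]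
    split_ifs with ht
    · rfl
    · by_contra h
      exact ht (IsMorseMatching.edge_mem hC hm
        (morseEdge_of_edgeWeight_ne_zero fun h0 => h h0.symm)).2
  | succ n ih =>
    rw [pathWeight]
    have h1 : ∀ v ∈ C.cells, C.edgeWeight m s v * C.pathWeight m (n + 1) v t =
        ∑ w ∈ C.cells, C.edgeWeight m s v * (C.pathWeight m n v w * C.edgeWeight m w t) :=
      fun v hv => by rw [ih hv, Finset.mul_sum]
    rw [Finset.sum_congr rfl h1, Finset.sum_comm]
    refine Finset.sum_congr rfl fun w _ => ?_
    rw [pathWeight, Finset.sum_mul]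
    exact Finset.sum_congr rfl fun v _ => by ring

end Rank

/-- The weighted number of all paths from `s` to `t` in the Morse graph. -/
def pathSum (C : CellData F α) (m : Finset (α × α)) (s t : α) : F :=
  ∑ n ∈ Finset.range C.cells.card, C.pathWeight m n s t

/-- The geometric series identity `S = 1 + S * W` for the weight matrix `W`: shifting the index adds
the term of length `C.cells.card`, which vanishes, and drops the empty path. -/
theorem pathSum_eq (hC : C.IsFilteredComplex) (hm : C.IsMorseMatching m) {s : α}
    (hs : s ∈ C.cells) (t : α) :
    C.pathSum m s t =
      (if s = t then 1 else 0) + ∑ v ∈ C.cells, C.pathSum m s v * C.edgeWeight m v t := by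
  have h1 : ∑ v ∈ C.cells, C.pathSum m s v * C.edgeWeight m v t =
      ∑ n ∈ Finset.range C.cells.card, C.pathWeight m (n + 1) s t := by
    simp only [pathSum, Finset.sum_mul]
    rw [Finset.sum_comm]
    exact Finset.sum_congr rfl fun n _ => (pathWeight_succ_right hC hm n hs t).symm
  have h2 : C.pathWeight m C.cells.card s t = 0 := by
    by_contra h
    have := le_morseRank_of_pathWeight_ne_zero hC hm h
    have := morseRank_lt_card hm hs
    omega
  have h3 := Finset.sum_range_succ (fun n => C.pathWeight m n s t) C.cells.card
  rw [Finset.sum_range_succ', h2, add_zero] at h3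
  rw [h1, pathSum, ← h3, add_comm]
  rfl

end MorseGraph

end CellData

namespace CellData

universe u v

variable {F : Type u} [Field F] {α : Type v}

/-! ### The Morse complex as a subcomplex -/

section Lift

variable [DecidableEq α] {C : CellData F α} {m : Finset (α × α)}

/-- No coface of the lower cell of a matched pair enters the filtration before the upper cell. -/
def IsEarliest (C : CellData F α) (m : Finset (α × α)) : Prop :=
  ∀ q ∈ m, ∀ c, C.κ c q.2 ≠ 0 → C.g q.1 ≤ C.g c

/-- The chain of `C` that represents the critical cell `s`: the cell itself, plus the upper cells
reached from it along gradient paths. -/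
noncomputable def lift (C : CellData F α) (m : Finset (α × α)) (s : α) : α →₀ F :=
  ∑ v ∈ C.cells with C.dim v = C.dim s, Finsupp.single v (C.pathSum m s v)

theorem lift_apply (s t : α) :
    C.lift m s t = if t ∈ C.cells ∧ C.dim t = C.dim s then C.pathSum m s t else 0 := by
  simp only [lift, Finsupp.finsetSum_apply, Finsupp.single_apply, Finset.sum_ite_eq',
    Finset.mem_filter]

section

variable (hC : C.IsFilteredComplex) (hm : C.IsMorseMatching m) (he : C.IsEarliest m)

include hC hm

/-- A chain of upper cells whose boundary avoids all lower cells vanishes. -/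
theorem eq_zero_of_boundary_snd_eq_zero {x : α →₀ F} (hx : ∀ v, x v ≠ 0 → ∃ q ∈ m, q.1 = v)
    (hb : ∀ q ∈ m, C.boundary x q.2 = 0) : x = 0 := by
  by_contra hne
  obtain ⟨A, hA, hmax⟩ := Finset.exists_max_image x.support (C.morseRank m)
    (Finsupp.support_nonempty_iff.2 hne)
  rw [Finsupp.mem_support_iff] at hA
  obtain ⟨q, hq, rfl⟩ := hx A hA
  have h := hb q hq
  -- Any other `v` in the support with face `q.2` gives edges `v → q.2 → q.1`, hence a larger rank
  -- than the maximal one of `q.1`. So the coefficient at `q.2` comes from `q.1` alone and cannot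
  -- vanish.
  rw [hC.boundary_apply, Finset.sum_eq_single q.1] at h
  · exact mul_ne_zero hA (hm.face q hq) h
  · intro v _ hv
    by_contra hne
    have hk := right_ne_zero_of_mul hne
    have h1 : C.MorseEdge m v q.2 := Or.inl ⟨hk, fun hvq =>
      hv (congrArg Prod.fst (hm.disjoint _ hvq q hq (Or.inr (Or.inl rfl))))⟩
    have h2 : C.MorseEdge m q.2 q.1 := Or.inr hq
    have h3 := morseRank_lt hC hm h1
    have h4 := morseRank_lt hC hm h2
    have h5 := hmax v (Finsupp.mem_support_iff.2 (left_ne_zero_of_mul hne))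
    omega
  · exact fun h => absurd (hm.mem q hq).1 h

include he

/-- Upward edges start at lower cells and end at upper cells, so two never follow each other. A path
from a critical cell therefore zigzags between two dimensions, and after falling two dimensions it
cannot come back. An upward step does not exceed `g s`: its lower cell was entered from a coface,
which by `IsEarliest` is no earlier than the upper cell. -/
theorem pathWeight_ne_zero {s : α} (hs : s ∈ C.critical m) {n : ℕ} {t : α}
    (h : C.pathWeight m n s t ≠ 0) :
    (C.dim t = C.dim s ∧ (t = s ∨ ∃ q ∈ m, q.1 = t) ∧ C.g t ≤ C.g s) ∨
      (C.dim t + 1 = C.dim s ∧ ∀ q ∈ m, q.2 = t → C.g q.1 ≤ C.g s) ∨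
      C.dim t + 2 ≤ C.dim s := by
  obtain ⟨hsC, hs1, hs2⟩ := mem_critical.1 hs
  induction n generalizing t with
  | zero =>
    rw [pathWeight] at h
    split_ifs at h with hst
    · subst hst
      exact Or.inl ⟨rfl, Or.inl rfl, le_rfl⟩
    · exact absurd rfl h
  | succ n ih =>
    rw [pathWeight_succ_right hC hm n hsC] at h
    obtain ⟨v, -, hv⟩ := Finset.exists_ne_zero_of_sum_ne_zero h
    have hI := ih (left_ne_zero_of_mul hv)
    rcases morseEdge_of_edgeWeight_ne_zero (right_ne_zero_of_mul hv) with ⟨hk, -⟩ | hup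
    · have hd := hC.dim_eq _ _ hk
      rcases hI with ⟨h1, -, h3⟩ | ⟨h1, -⟩ | h1
      · refine Or.inr (Or.inl ⟨by omega, ?_⟩)
        rintro q hq rfl
        exact (he q hq v hk).trans h3
      · exact Or.inr (Or.inr (by omega))
      · exact Or.inr (Or.inr (by omega))
    · have hd : C.dim t = C.dim v + 1 := hC.dim_eq _ _ (hm.face _ hup)
      rcases hI with ⟨h1, h2, h3⟩ | ⟨h1, h2⟩ | h1
      · rcases h2 with rfl | ⟨q, hq, rfl⟩
        · exact absurd rfl (hs2 _ hup)
        · exact absurd rfl (hm.fst_ne_snd hC hq hup)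
      · exact Or.inl ⟨by omega, Or.inr ⟨_, hup, rfl⟩, h2 _ hup rfl⟩
      · by_cases h3 : C.dim t + 1 = C.dim s
        · exact Or.inr (Or.inl ⟨h3, fun q hq hqt => absurd hqt.symm (hm.fst_ne_snd hC hup hq)⟩)
        · exact Or.inr (Or.inr (by omega))

theorem pathSum_ne_zero {s : α} (hs : s ∈ C.critical m) {t : α} (h : C.pathSum m s t ≠ 0) :
    (C.dim t = C.dim s ∧ (t = s ∨ ∃ q ∈ m, q.1 = t) ∧ C.g t ≤ C.g s) ∨ C.dim t < C.dim s := by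
  obtain ⟨n, -, hn⟩ := Finset.exists_ne_zero_of_sum_ne_zero h
  rcases pathWeight_ne_zero hC hm he hs hn with h | h | h
  · exact Or.inl h
  · exact Or.inr (by omega)
  · exact Or.inr (by omega)

theorem lift_ne_zero {s : α} (hs : s ∈ C.critical m) {t : α} (h : C.lift m s t ≠ 0) :
    t ∈ C.cells ∧ C.dim t = C.dim s ∧ (t = s ∨ ∃ q ∈ m, q.1 = t) ∧ C.g t ≤ C.g s := by
  rw [lift_apply] at h
  split_ifs at h with h1
  · rcases pathSum_ne_zero hC hm he hs h with h2 | h2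
    · exact ⟨h1.1, h2⟩
    · omega
  · exact absurd rfl h

theorem lift_mem_chains {s : α} (hs : s ∈ C.critical m) :
    C.lift m s ∈ C.chains (C.dim s) (C.g s) := by
  refine mem_chains.2 fun c hc => ?_
  obtain ⟨h1, h2, -, h3⟩ := lift_ne_zero hC hm he hs hc
  exact ⟨h1, h2, WithTop.coe_le_coe.2 h3⟩

theorem lift_self {s : α} (hs : s ∈ C.critical m) : C.lift m s s = 1 := by
  have hsC := (mem_critical.1 hs).1
  rw [lift_apply, if_pos ⟨hsC, rfl⟩, pathSum_eq hC hm hsC, if_pos rfl, Finset.sum_eq_zero, add_zero]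
  intro v _
  by_contra h
  rw [edgeWeight_critical hs] at h
  have h1 := hC.dim_eq _ _ (right_ne_zero_of_mul h)
  rcases pathSum_ne_zero hC hm he hs (left_ne_zero_of_mul h) with h2 | h2 <;> omega

theorem lift_apply_critical {s t : α} (hs : s ∈ C.critical m) (ht : t ∈ C.critical m) :
    C.lift m s t = if s = t then 1 else 0 := by
  split_ifs with h
  · rw [← h]; exact lift_self hC hm he hs
  · by_contra hne
    obtain ⟨-, -, h1 | ⟨q, hq, rfl⟩, -⟩ := lift_ne_zero hC hm he hs hne
    · exact h h1.symm
    · exact (mem_critical.1 ht).2.1 q hq rfl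

theorem lift_apply_snd {s : α} (hs : s ∈ C.critical m) {q : α × α} (hq : q ∈ m) :
    C.lift m s q.2 = 0 := by
  by_contra hne
  obtain ⟨-, -, h1 | ⟨r, hr, h1⟩, -⟩ := lift_ne_zero hC hm he hs hne
  · exact (mem_critical.1 hs).2.2 q hq h1
  · exact hm.fst_ne_snd hC hr hq h1

theorem pathSum_mul_κ {s t : α} (hd : C.dim s = C.dim t + 1)
    {v : α} (hv : v ∈ C.cells) : C.pathSum m s v * C.κ v t = C.lift m s v * C.κ v t := by
  by_cases hk : C.κ v t = 0
  · simp [hk]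
  · rw [lift_apply, if_pos ⟨hv, by rw [hC.dim_eq _ _ hk, hd]⟩]

/-- All edges into a critical cell are ordinary incidences, so splitting off the last edge of the
paths to `t` gives exactly the coefficient of the boundary. -/
theorem boundary_lift_critical {s t : α} (hs : s ∈ C.critical m) (ht : t ∈ C.critical m) :
    C.boundary (C.lift m s) t = (C.morseComplex m).κ s t := by
  have hsC := (mem_critical.1 hs).1
  by_cases hd : C.dim s = C.dim t + 1
  · have hst : s ≠ t := by rintro rfl; omega
    have : (C.morseComplex m).κ s t = C.pathSum m s t := if_pos ⟨hs, ht, hd⟩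
    rw [this, pathSum_eq hC hm hsC, if_neg hst, zero_add, hC.boundary_apply]
    refine Finset.sum_congr rfl fun v hv => ?_
    rw [edgeWeight_critical ht, pathSum_mul_κ hC hm he hd hv]
  · have : (C.morseComplex m).κ s t = 0 := if_neg fun h => hd h.2.2
    rw [this]
    by_contra h
    obtain ⟨v, -, h1, h2⟩ := hC.exists_of_boundary_apply_ne_zero h
    obtain ⟨-, h3, -⟩ := lift_ne_zero hC hm he hs h1
    have := hC.dim_eq _ _ h2
    omega

/-- The paths to the lower cell `q.2` collect the boundary contributions of all cells except `q.1`.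
The weight `-κ⁻¹` of the reversed edge gives `q.1` the coefficient that cancels them. -/
theorem boundary_lift_snd {s : α} (hs : s ∈ C.critical m) {q : α × α} (hq : q ∈ m) :
    C.boundary (C.lift m s) q.2 = 0 := by
  obtain ⟨hsC, hs1, hs2⟩ := mem_critical.1 hs
  by_cases hd : C.dim s = C.dim q.2 + 1
  · have hk := hm.face q hq
    have hdq := hC.dim_eq _ _ hk
    have h1 : C.pathSum m s q.2 = ∑ v ∈ C.cells.erase q.1, C.lift m s v * C.κ v q.2 := by
      rw [pathSum_eq hC hm hsC, if_neg fun h => hs2 q hq h.symm, zero_add,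
        ← Finset.add_sum_erase _ _ (hm.mem q hq).1, hm.edgeWeight_snd hC hq, if_pos rfl, mul_zero,
        zero_add]
      refine Finset.sum_congr rfl fun v hv => ?_
      rw [Finset.mem_erase] at hv
      rw [hm.edgeWeight_snd hC hq, if_neg hv.1, pathSum_mul_κ hC hm he hd hv.2]
    have h2 : C.lift m s q.1 = C.pathSum m s q.2 * -(C.κ q.1 q.2)⁻¹ := by
      rw [lift_apply, if_pos ⟨(hm.mem q hq).1, by omega⟩, pathSum_eq hC hm hsC,
        if_neg fun h => hs1 q hq h.symm, zero_add, Finset.sum_eq_single q.2,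
        hm.edgeWeight_fst hC hq, if_pos rfl]
      · intro v _ hv
        by_contra h
        rw [hm.edgeWeight_fst hC hq, if_neg hv] at h
        have h3 := hC.dim_eq _ _ (right_ne_zero_of_mul h)
        rcases pathSum_ne_zero hC hm he hs (left_ne_zero_of_mul h) with h4 | h4 <;> omega
      · exact fun h => absurd (hm.mem q hq).2 h
    rw [hC.boundary_apply, ← Finset.add_sum_erase _ _ (hm.mem q hq).1, ← h1, h2]
    field_simp
    ring
  · by_contra h
    obtain ⟨v, -, h1, h2⟩ := hC.exists_of_boundary_apply_ne_zero h
    obtain ⟨-, h3, -⟩ := lift_ne_zero hC hm he hs h1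
    have := hC.dim_eq _ _ h2
    omega

/-- The linear extension of `lift`. -/
noncomputable def liftMap (C : CellData F α) (m : Finset (α × α)) : (α →₀ F) →ₗ[F] (α →₀ F) :=
  Finsupp.linearCombination F (C.lift m)

/-- The difference of the two sides vanishes at critical and at lower cells, so it is a chain of
upper cells. Its boundary vanishes at lower cells by `∂∂ = 0` and `boundary_lift_snd`, hence it is
zero by `eq_zero_of_boundary_snd_eq_zero`. -/
theorem boundary_lift {s : α} (hs : s ∈ C.critical m) :
    C.boundary (C.lift m s) = ∑ t ∈ C.critical m, (C.morseComplex m).κ s t • C.lift m t := by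
  rw [← sub_eq_zero]
  apply eq_zero_of_boundary_snd_eq_zero hC hm
  · intro v hv
    by_contra hcon
    apply hv
    by_cases hvC : v ∈ C.cells
    · rw [Finsupp.sub_apply, Finsupp.finsetSum_apply]
      simp only [Finsupp.smul_apply, smul_eq_mul]
      by_cases hv2 : ∃ q ∈ m, q.2 = v
      · obtain ⟨q, hq, rfl⟩ := hv2
        rw [boundary_lift_snd hC hm he hs hq, Finset.sum_eq_zero, sub_zero]
        intro t ht
        rw [lift_apply_snd hC hm he ht hq, mul_zero]
      · push Not at hcon hv2
        have hvc : v ∈ C.critical m := mem_critical.2 ⟨hvC, hcon, hv2⟩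
        rw [boundary_lift_critical hC hm he hs hvc, Finset.sum_eq_single v, lift_self hC hm he hvc,
          mul_one, sub_self]
        · intro t ht htv
          rw [lift_apply_critical hC hm he ht hvc, if_neg htv, mul_zero]
        · exact fun h => absurd hvc h
    · rw [Finsupp.sub_apply, Finsupp.finsetSum_apply, Finset.sum_eq_zero, sub_zero]
      · by_contra h
        obtain ⟨w, -, -, h2⟩ := hC.exists_of_boundary_apply_ne_zero h
        exact hvC (hC.mem_right _ _ h2)
      · intro t ht
        by_contra h
        exact hvC (lift_ne_zero hC hm he ht (right_ne_zero_of_mul h)).1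
  · intro q hq
    rw [map_sub, hC.boundary_boundary_apply, map_sum, zero_sub, Finsupp.neg_apply,
      Finsupp.finsetSum_apply, Finset.sum_eq_zero, neg_zero]
    intro t ht
    rw [map_smul, Finsupp.smul_apply, boundary_lift_snd hC hm he ht hq, smul_zero]

theorem liftMap_apply_critical {x : α →₀ F} (hx : ∀ v, x v ≠ 0 → v ∈ C.critical m) {t : α}
    (ht : t ∈ C.critical m) : C.liftMap m x t = x t := by
  rw [liftMap, Finsupp.linearCombination_apply, Finsupp.sum, Finsupp.finsetSum_apply]
  have h1 : ∀ v ∈ x.support, (x v • C.lift m v) t = if v = t then x v else 0 := by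
    intro v hv
    rw [Finsupp.smul_apply, lift_apply_critical hC hm he (hx v (Finsupp.mem_support_iff.1 hv)) ht]
    simp
  rw [Finset.sum_congr rfl h1, Finset.sum_ite_eq']
  split_ifs with h
  · rfl
  · exact (Finsupp.notMem_support_iff.1 h).symm

theorem liftMap_apply_snd {x : α →₀ F} (hx : ∀ v, x v ≠ 0 → v ∈ C.critical m) {q : α × α}
    (hq : q ∈ m) : C.liftMap m x q.2 = 0 := by
  rw [liftMap, Finsupp.linearCombination_apply, Finsupp.sum, Finsupp.finsetSum_apply]
  refine Finset.sum_eq_zero fun v hv => ?_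
  rw [Finsupp.smul_apply, lift_apply_snd hC hm he (hx v (Finsupp.mem_support_iff.1 hv)) hq,
    smul_zero]

theorem boundary_liftMap {x : α →₀ F} (hx : ∀ v, x v ≠ 0 → v ∈ C.critical m) :
    C.boundary (C.liftMap m x) = C.liftMap m ((C.morseComplex m).boundary x) := by
  have h1 : x = ∑ v ∈ x.support, x v • Finsupp.single v (1 : F) := by
    conv_lhs => rw [← Finsupp.sum_single x, Finsupp.sum]
    simp
  rw [h1]
  simp only [map_sum, map_smul]
  refine Finset.sum_congr rfl fun v hv => ?_
  have hvc := hx v (Finsupp.mem_support_iff.1 hv)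
  have h2 : C.liftMap m (Finsupp.single v 1) = C.lift m v := by simp [liftMap]
  rw [h2, boundary_lift hC hm he hvc, boundary_single, map_sum]
  congr 1
  refine Finset.sum_congr rfl fun t _ => ?_
  simp [liftMap]

/-- Incidences of the Morse complex are coordinates of boundaries of lifts, which stay within the
filtration. Applying `∂` to `boundary_lift` and reading critical coordinates gives `∂∂ = 0`. -/
theorem isFilteredComplex_morseComplex : (C.morseComplex m).IsFilteredComplex := by
  have hcrit : ∀ s t, (C.morseComplex m).κ s t ≠ 0 →
      s ∈ C.critical m ∧ t ∈ C.critical m ∧ C.dim s = C.dim t + 1 := by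
    intro s t h
    by_contra hn
    exact h (if_neg hn)
  refine ⟨fun s t h => (hcrit s t h).1, fun s t h => (hcrit s t h).2.1,
    fun s t h => (hcrit s t h).2.2, fun s t h => ?_, fun s t => ?_⟩
  · obtain ⟨hs, ht, -⟩ := hcrit s t h
    rw [← boundary_lift_critical hC hm he hs ht] at h
    obtain ⟨v, -, h1, h2⟩ := hC.exists_of_boundary_apply_ne_zero h
    exact (hC.g_le _ _ h2).trans (lift_ne_zero hC hm he hs h1).2.2.2
  · by_contra h
    obtain ⟨b, hb, hne⟩ := Finset.exists_ne_zero_of_sum_ne_zero h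
    obtain ⟨hs, -, -⟩ := hcrit _ _ (left_ne_zero_of_mul hne)
    obtain ⟨-, ht, -⟩ := hcrit _ _ (right_ne_zero_of_mul hne)
    have h1 := congrArg (fun y => C.boundary y t) (boundary_lift hC hm he hs)
    simp only [hC.boundary_boundary_apply, map_sum, map_smul, Finsupp.finsetSum_apply,
      Finsupp.smul_apply, smul_eq_mul, Finsupp.coe_zero, Pi.zero_apply] at h1
    apply h
    rw [h1]
    exact Finset.sum_congr rfl fun v hv => by rw [boundary_lift_critical hC hm he hv ht]

/-- These are the two facts that preserve the loop invariant `IsReduced`: the first transfers strict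
decrease of `g`, the second forbids new nonzero boundaries. -/
theorem morseComplex_κ_ne_zero {s t : α} (h : (C.morseComplex m).κ s t ≠ 0) :
    (∃ v, C.κ v t ≠ 0 ∧ C.g v ≤ C.g s) ∧ ∃ b, C.κ s b ≠ 0 := by
  have hcrit : s ∈ C.critical m ∧ t ∈ C.critical m ∧ C.dim s = C.dim t + 1 := by
    by_contra hn
    exact h (if_neg hn)
  obtain ⟨hs, ht, hd⟩ := hcrit
  constructor
  · rw [← boundary_lift_critical hC hm he hs ht] at h
    obtain ⟨v, -, h1, h2⟩ := hC.exists_of_boundary_apply_ne_zero h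
    exact ⟨v, h2, (lift_ne_zero hC hm he hs h1).2.2.2⟩
  · have h1 : (C.morseComplex m).κ s t = C.pathSum m s t := if_pos ⟨hs, ht, hd⟩
    rw [h1] at h
    obtain ⟨n, -, hn⟩ := Finset.exists_ne_zero_of_sum_ne_zero h
    cases n with
    | zero =>
      exact absurd (if_neg (by rintro rfl; omega)) hn
    | succ n =>
      obtain ⟨v, -, hv⟩ := Finset.exists_ne_zero_of_sum_ne_zero hn
      rw [edgeWeight_critical_left hs] at hv
      exact ⟨v, left_ne_zero_of_mul hv⟩

end

/-- Without pairs every lift is the cell itself. The equality is literal, as the notion of fixed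
point requires. -/
theorem morseComplex_empty (hC : C.IsFilteredComplex) (hm : C.IsMorseMatching ∅) :
    C.morseComplex ∅ = C := by
  have he : C.IsEarliest ∅ := fun q hq => absurd hq (Finset.notMem_empty q)
  have hcrit : C.critical ∅ = C.cells := by ext c; simp [mem_critical]
  refine CellData.ext hcrit rfl rfl ?_
  funext s t
  by_cases h : s ∈ C.cells ∧ t ∈ C.cells
  · have hs : s ∈ C.critical ∅ := hcrit ▸ h.1
    rw [← boundary_lift_critical hC hm he hs (hcrit ▸ h.2), hC.boundary_apply,
      Finset.sum_eq_single s, lift_self hC hm he hs, one_mul]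
    · intro v _ hvs
      by_contra hne
      obtain ⟨-, -, h1 | ⟨q, hq, -⟩, -⟩ := lift_ne_zero hC hm he hs (left_ne_zero_of_mul hne)
      · exact hvs h1
      · simp at hq
    · exact fun hn => absurd h.1 hn
  · have h1 : (C.morseComplex ∅).κ s t = 0 :=
      if_neg fun hn => h ⟨hcrit ▸ hn.1, hcrit ▸ hn.2.1⟩
    rw [h1]
    by_contra hne
    exact h ⟨hC.mem_left s t fun h0 => hne h0.symm, hC.mem_right s t fun h0 => hne h0.symm⟩

end Lift

end CellData

/-! ### Spans of subfamilies of an independent family -/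

section Span

variable {F V ι : Type*} [Field F] [AddCommGroup V] [Module F V] {e : ι → V} {N : Set ι}

theorem LinearIndepOn.span_image_inf_span_image (h : LinearIndepOn F e N) {I J : Set ι}
    (hI : I ⊆ N) (hJ : J ⊆ N) :
    Submodule.span F (e '' I) ⊓ Submodule.span F (e '' J) = Submodule.span F (e '' (I ∩ J)) := by
  refine le_antisymm ?_ (le_inf (Submodule.span_mono (Set.image_mono Set.inter_subset_left))
    (Submodule.span_mono (Set.image_mono Set.inter_subset_right)))
  rintro x ⟨hx, hy⟩
  simp only [SetLike.mem_coe, Finsupp.span_image_eq_map_linearCombination, Submodule.mem_map]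
    at hx hy ⊢
  obtain ⟨f, hf, rfl⟩ := hx
  obtain ⟨k, hk, hfk⟩ := hy
  have : k = f := linearIndepOn_iffₛ.1 h k (Finsupp.supported_mono hJ hk) f
    (Finsupp.supported_mono hI hf) hfk
  subst this
  refine ⟨k, ?_, rfl⟩
  rw [Finsupp.supported_inter]
  exact ⟨hf, hk⟩

theorem LinearIndepOn.finrank_span_image_finset {N : Finset ι}
    (h : LinearIndepOn F e (N : Set ι)) :
    Module.finrank F (Submodule.span F (e '' (N : Set ι))) = N.card := by
  have h1 := finrank_span_eq_card (R := F) (b := fun i : (N : Set ι) => e i) h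
  rw [Set.image_eq_range]
  simpa using h1

end Span

namespace CellData

universe u v

variable {F : Type u} [Field F] {α : Type v}

/-! ### Persistent Betti numbers as dimensions of spaces of chains -/

section Betti

variable (C : CellData F α)

instance finiteDimensional_chains (p : ℕ) (t : WithTop ℤ) :
    FiniteDimensional F (C.chains p t) := by
  have : Finite {c | c ∈ C.cells ∧ C.dim c = p ∧ (C.g c : WithTop ℤ) ≤ t} :=
    C.cells.finite_toSet.subset fun c hc => hc.1
  exact Module.Finite.equiv (Finsupp.supportedEquivFinsupp (R := F) (M := F)
    {c | c ∈ C.cells ∧ C.dim c = p ∧ (C.g c : WithTop ℤ) ≤ t}).symm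

instance finiteDimensional_cycles (p : ℕ) (t : WithTop ℤ) :
    FiniteDimensional F (C.cycles p t) :=
  Submodule.finiteDimensional_of_le inf_le_left

theorem finrank_chains (p : ℕ) (t : WithTop ℤ) :
    Module.finrank F (C.chains p t) =
      (C.cells.filter fun c => C.dim c = p ∧ (C.g c : WithTop ℤ) ≤ t).card := by
  have h : {c | c ∈ C.cells ∧ C.dim c = p ∧ (C.g c : WithTop ℤ) ≤ t} =
      ((C.cells.filter fun c => C.dim c = p ∧ (C.g c : WithTop ℤ) ≤ t : Finset α) : Set α) := by
    ext c; simp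
  rw [chains, h, (Finsupp.supportedEquivFinsupp _).finrank_eq, Module.finrank_finsupp_self]
  simp

/-- Rank–nullity for the composite from cycles at `s` to homology at `t`, whose kernel consists of
the cycles that bound at `t`. -/
theorem persistentBetti_eq (p : ℕ) {s t : WithTop ℤ} (h : s ≤ t) :
    C.persistentBetti p s t = (Module.finrank F (C.cycles p s) : ℤ) -
      Module.finrank F (C.cycles p s ⊓ C.boundaries p t : Submodule F (α →₀ F)) := by
  rw [persistentBetti, dif_pos h]
  let L : C.cycles p s →ₗ[F] C.homology p t :=
    C.homologyMap p h ∘ₗ Submodule.mkQ ((C.boundaries p s).submoduleOf (C.cycles p s))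
  have h1 : LinearMap.range L = LinearMap.range (C.homologyMap p h) :=
    LinearMap.range_comp_of_range_eq_top _ (Submodule.range_mkQ _)
  have h2 : (LinearMap.ker L).map (C.cycles p s).subtype = C.cycles p s ⊓ C.boundaries p t := by
    have h3 : LinearMap.ker L = (C.boundaries p t).submoduleOf (C.cycles p s) := by
      ext z
      have : L z = Submodule.Quotient.mk (Submodule.inclusion (C.cycles_mono p h) z) := rfl
      rw [LinearMap.mem_ker, this, Submodule.Quotient.mk_eq_zero]
      rfl
    rw [h3, Submodule.submoduleOf, Submodule.map_comap_subtype]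
  have h4 : Module.finrank F (LinearMap.ker L) =
      Module.finrank F (C.cycles p s ⊓ C.boundaries p t : Submodule F (α →₀ F)) := by
    rw [← h2]
    exact (Submodule.equivMapOfInjective _ (Submodule.injective_subtype _) _).finrank_eq
  have h5 := LinearMap.finrank_range_add_finrank_ker L
  rw [h1, h4] at h5
  omega

end Betti

/-! ### Standard bases -/

/-- A basis of the chains of `C`, adapted to dimension and filtration, in which the boundary
operator is in normal form: it maps the first basis vector of each pair of `P` to the second, and
every other basis vector to zero. -/
structure IsStandardBasis (C : CellData F α) (P : Finset (α × α)) (e : α → α →₀ F) : Prop where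
  mem_chains : ∀ c ∈ C.cells, e c ∈ C.chains (C.dim c) (C.g c)
  linearIndepOn : LinearIndepOn F e (C.cells : Set α)
  pair_mem : ∀ q ∈ P, q.1 ∈ C.cells ∧ q.2 ∈ C.cells
  injective : ∀ q ∈ P, ∀ r ∈ P, q.1 = r.1 ∨ q.2 = r.2 → q = r
  fst_ne_snd : ∀ q ∈ P, ∀ r ∈ P, q.1 ≠ r.2
  dim_eq : ∀ q ∈ P, C.dim q.1 = C.dim q.2 + 1
  g_le : ∀ q ∈ P, C.g q.2 ≤ C.g q.1
  boundary_fst : ∀ q ∈ P, C.boundary (e q.1) = e q.2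
  boundary_eq_zero : ∀ c ∈ C.cells, (∀ q ∈ P, q.1 ≠ c) → C.boundary (e c) = 0

namespace IsStandardBasis

variable [DecidableEq α] {C : CellData F α} {P : Finset (α × α)} {e : α → α →₀ F}
  (he : C.IsStandardBasis P e)

include he

/-- Adaptedness gives one inclusion; independence and a count of cells give equality. -/
theorem chains_eq_span (p : ℕ) (t : WithTop ℤ) : C.chains p t = Submodule.span F
    (e '' (C.cells.filter fun c => C.dim c = p ∧ (C.g c : WithTop ℤ) ≤ t : Finset α)) := by
  symm
  apply Submodule.eq_of_le_of_finrank_eq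
  · rw [Submodule.span_le]
    rintro _ ⟨c, hc, rfl⟩
    rw [Finset.mem_coe, Finset.mem_filter] at hc
    obtain ⟨hc, rfl, ht⟩ := hc
    exact C.chains_mono _ ht (he.mem_chains c hc)
  · rw [finrank_chains, LinearIndepOn.finrank_span_image_finset]
    exact he.linearIndepOn.mono (Finset.coe_subset.2 (Finset.filter_subset _ _))

/-- The vectors `e q.2` are independent, so a cycle has zero coefficient at every `e q.1`. -/
theorem cycles_eq_span (p : ℕ) (t : WithTop ℤ) : C.cycles p t = Submodule.span F
    (e '' (C.cells.filter fun c => (C.dim c = p ∧ (C.g c : WithTop ℤ) ≤ t) ∧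
      ∀ q ∈ P, q.1 ≠ c : Finset α)) := by
  apply le_antisymm
  · rintro z ⟨hz, hz0⟩
    rw [he.chains_eq_span, SetLike.mem_coe, Submodule.mem_span_image_finset_iff_exists_fun'] at hz
    obtain ⟨f, rfl⟩ := hz
    rw [SetLike.mem_coe, LinearMap.mem_ker, map_sum] at hz0
    simp only [map_smul] at hz0
    set J := C.cells.filter fun c => C.dim c = p ∧ (C.g c : WithTop ℤ) ≤ t with hJ
    have hf : ∀ q ∈ P, q.1 ∈ J → f q.1 = 0 := by
      have h1 : ∑ c ∈ J, f c • C.boundary (e c) = ∑ q ∈ P with q.1 ∈ J, f q.1 • e q.2 := by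
        have h2 : ∑ q ∈ P with q.1 ∈ J, f q.1 • e q.2 =
            ∑ c ∈ (P.filter fun q => q.1 ∈ J).image Prod.fst, f c • C.boundary (e c) := by
          rw [Finset.sum_image]
          · refine Finset.sum_congr rfl fun q hq => ?_
            rw [he.boundary_fst q (Finset.mem_filter.1 hq).1]
          · intro q hq r hr h
            exact he.injective q (Finset.mem_filter.1 hq).1 r (Finset.mem_filter.1 hr).1 (Or.inl h)
        rw [h2]
        symm
        apply Finset.sum_subset
        · intro c hc
          obtain ⟨q, hq, rfl⟩ := Finset.mem_image.1 hc
          exact (Finset.mem_filter.1 hq).2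
        · intro c hc hn
          rw [he.boundary_eq_zero c (Finset.mem_filter.1 hc).1, smul_zero]
          rintro q hq rfl
          exact hn (Finset.mem_image_of_mem _ (Finset.mem_filter.2 ⟨hq, hc⟩))
      rw [h1] at hz0
      have hli : LinearIndepOn F (fun q : α × α => e q.2)
          (P.filter fun q => q.1 ∈ J : Finset (α × α)) := by
        have : LinearIndepOn F e (Prod.snd '' ((P.filter fun q => q.1 ∈ J : Finset (α × α)) : Set (α × α))) := by
          refine he.linearIndepOn.mono ?_
          rintro _ ⟨q, hq, rfl⟩
          exact (he.pair_mem q (Finset.mem_filter.1 hq).1).2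
        exact this.comp_of_image fun q hq r hr h =>
          he.injective q (Finset.mem_filter.1 hq).1 r (Finset.mem_filter.1 hr).1 (Or.inr h)
      intro q hq hqJ
      exact linearIndepOn_finset_iff.1 hli (fun q => f q.1) hz0 q (Finset.mem_filter.2 ⟨hq, hqJ⟩)
    refine Submodule.sum_mem _ fun c hc => ?_
    by_cases hcP : ∀ q ∈ P, q.1 ≠ c
    · refine Submodule.smul_mem _ _ (Submodule.subset_span ⟨c, ?_, rfl⟩)
      rw [Finset.mem_coe, Finset.mem_filter]
      exact ⟨(Finset.mem_filter.1 hc).1, (Finset.mem_filter.1 hc).2, hcP⟩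
    · push Not at hcP
      obtain ⟨q, hq, rfl⟩ := hcP
      rw [hf q hq hc, zero_smul]
      exact Submodule.zero_mem _
  · rw [Submodule.span_le]
    rintro _ ⟨c, hc, rfl⟩
    rw [Finset.mem_coe, Finset.mem_filter] at hc
    obtain ⟨hc, ⟨rfl, ht⟩, hP⟩ := hc
    exact ⟨C.chains_mono _ ht (he.mem_chains c hc), he.boundary_eq_zero c hc hP⟩

theorem boundaries_eq_span (p : ℕ) (t : WithTop ℤ) : C.boundaries p t = Submodule.span F
    (e '' ((P.filter fun q => C.dim q.2 = p ∧ (C.g q.1 : WithTop ℤ) ≤ t).image Prod.snd :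
      Finset α)) := by
  rw [boundaries, he.chains_eq_span, Submodule.map_span]
  apply le_antisymm
  · rw [Submodule.span_le]
    rintro _ ⟨_, ⟨c, hc, rfl⟩, rfl⟩
    rw [Finset.mem_coe, Finset.mem_filter] at hc
    obtain ⟨hc, hd, ht⟩ := hc
    by_cases hcP : ∀ q ∈ P, q.1 ≠ c
    · rw [he.boundary_eq_zero c hc hcP]
      exact Submodule.zero_mem _
    · push Not at hcP
      obtain ⟨q, hq, rfl⟩ := hcP
      rw [he.boundary_fst q hq]
      refine Submodule.subset_span ⟨q.2, Finset.mem_coe.2 (Finset.mem_image_of_mem _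
        (Finset.mem_filter.2 ⟨hq, ?_, ht⟩)), rfl⟩
      have := he.dim_eq q hq
      omega
  · rw [Submodule.span_le]
    rintro _ ⟨c, hc, rfl⟩
    obtain ⟨q, hq', rfl⟩ := Finset.mem_image.1 (Finset.mem_coe.1 hc)
    obtain ⟨hq, rfl, ht⟩ := Finset.mem_filter.1 hq'
    exact Submodule.subset_span ⟨e q.1, ⟨q.1, Finset.mem_coe.2 (Finset.mem_filter.2
      ⟨(he.pair_mem q hq).1, he.dim_eq q hq, ht⟩), rfl⟩, he.boundary_fst q hq⟩

theorem finrank_cycles (p : ℕ) (s : WithTop ℤ) :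
    Module.finrank F (C.cycles p s) =
      ((C.critical P).filter fun c => C.dim c = p ∧ (C.g c : WithTop ℤ) ≤ s).card +
      (P.filter fun q => C.dim q.2 = p ∧ (C.g q.2 : WithTop ℤ) ≤ s).card := by
  rw [he.cycles_eq_span, LinearIndepOn.finrank_span_image_finset
    (he.linearIndepOn.mono (Finset.coe_subset.2 (Finset.filter_subset _ _)))]
  have hinj : Set.InjOn Prod.snd
      (P.filter fun q => C.dim q.2 = p ∧ (C.g q.2 : WithTop ℤ) ≤ s : Finset (α × α)) :=
    fun q hq r hr h => he.injective q (Finset.mem_filter.1 hq).1 r (Finset.mem_filter.1 hr).1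
      (Or.inr h)
  rw [← Finset.card_image_of_injOn hinj, ← Finset.card_union_of_disjoint]
  · congr 1
    ext c
    simp only [Finset.mem_filter, Finset.mem_union, Finset.mem_image, mem_critical]
    constructor
    · rintro ⟨hc, hd, h1⟩
      by_cases h2 : ∀ q ∈ P, q.2 ≠ c
      · exact Or.inl ⟨⟨hc, h1, h2⟩, hd⟩
      · push Not at h2
        obtain ⟨q, hq, rfl⟩ := h2
        exact Or.inr ⟨q, ⟨hq, hd⟩, rfl⟩
    · rintro (⟨⟨hc, h1, -⟩, hd⟩ | ⟨q, ⟨hq, hd⟩, rfl⟩)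
      · exact ⟨hc, hd, h1⟩
      · exact ⟨(he.pair_mem q hq).2, hd, fun r hr => he.fst_ne_snd r hr q hq⟩
  · rw [Finset.disjoint_left]
    intro c hc hc2
    obtain ⟨q, hq, rfl⟩ := Finset.mem_image.1 hc2
    exact (mem_critical.1 (Finset.mem_filter.1 hc).1).2.2 q (Finset.mem_filter.1 hq).1 rfl

theorem finrank_cycles_inf_boundaries (p : ℕ) (s t : WithTop ℤ) :
    Module.finrank F (C.cycles p s ⊓ C.boundaries p t : Submodule F (α →₀ F)) =
      (P.filter fun q => C.dim q.2 = p ∧ (C.g q.2 : WithTop ℤ) ≤ s ∧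
        (C.g q.1 : WithTop ℤ) ≤ t).card := by
  have hsub : ((P.filter fun q => C.dim q.2 = p ∧ (C.g q.1 : WithTop ℤ) ≤ t).image Prod.snd :
      Finset α) ⊆ C.cells := by
    intro c hc
    obtain ⟨q, hq, rfl⟩ := Finset.mem_image.1 hc
    exact (he.pair_mem q (Finset.mem_filter.1 hq).1).2
  rw [he.cycles_eq_span, he.boundaries_eq_span, he.linearIndepOn.span_image_inf_span_image
    (Finset.coe_subset.2 (Finset.filter_subset _ _)) (Finset.coe_subset.2 hsub),
    ← Finset.coe_inter, LinearIndepOn.finrank_span_image_finset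
    (he.linearIndepOn.mono (Finset.coe_subset.2 (Finset.inter_subset_right.trans hsub)))]
  have hinj : Set.InjOn Prod.snd
      (P.filter fun q => C.dim q.2 = p ∧ (C.g q.2 : WithTop ℤ) ≤ s ∧
        (C.g q.1 : WithTop ℤ) ≤ t : Finset (α × α)) :=
    fun q hq r hr h => he.injective q (Finset.mem_filter.1 hq).1 r (Finset.mem_filter.1 hr).1
      (Or.inr h)
  rw [← Finset.card_image_of_injOn hinj]
  congr 1
  ext c
  simp only [Finset.mem_filter, Finset.mem_inter, Finset.mem_image]
  constructor
  · rintro ⟨⟨hc, ⟨hd, hs⟩, -⟩, q, ⟨hq, -, ht⟩, rfl⟩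
    exact ⟨q, ⟨hq, hd, hs, ht⟩, rfl⟩
  · rintro ⟨q, ⟨hq, hd, hs, ht⟩, rfl⟩
    exact ⟨⟨(he.pair_mem q hq).2, ⟨hd, hs⟩, fun r hr => he.fst_ne_snd r hr q hq⟩,
      q, ⟨hq, hd, ht⟩, rfl⟩

/-- The classes born by `s` and alive at `t` come from unpaired cells and from pairs whose upper
cell enters after `t`. -/
theorem persistentBetti_eq_sum (p : ℕ) {s t : WithTop ℤ} (h : s ≤ t) :
    C.persistentBetti p s t =
      (∑ c ∈ C.critical P, if C.dim c = p ∧ (C.g c : WithTop ℤ) ≤ s then 1 else 0) +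
      ∑ q ∈ P, if C.dim q.2 = p ∧ (C.g q.2 : WithTop ℤ) ≤ s ∧ t < (C.g q.1 : WithTop ℤ)
        then 1 else 0 := by
  rw [C.persistentBetti_eq p h, he.finrank_cycles, he.finrank_cycles_inf_boundaries]
  push_cast [Finset.natCast_card_filter]
  rw [add_sub_assoc, ← Finset.sum_sub_distrib]
  congr 1
  refine Finset.sum_congr rfl fun q _ => ?_
  by_cases h1 : C.dim q.2 = p ∧ (C.g q.2 : WithTop ℤ) ≤ s
  · by_cases h2 : (C.g q.1 : WithTop ℤ) ≤ t
    · simp [h1.1, h1.2, h2, not_lt.2 h2]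
    · simp [h1.1, h1.2, h2, not_le.1 h2]
  · rw [if_neg h1, if_neg fun h2 => h1 ⟨h2.1, h2.2.1⟩, if_neg fun h2 => h1 ⟨h2.1, h2.2.1⟩, sub_zero]

end IsStandardBasis

/-- The intervals of a standard basis with pairs `P`: the nondegenerate intervals of the pairs, and
an infinite interval for each unpaired cell. -/
def standardIntervals [DecidableEq α] (C : CellData F α) (P : Finset (α × α)) :
    Multiset (ℕ × ℤ × WithTop ℤ) :=
  (C.matchedIntervals P).filter (fun x => (x.2.1 : WithTop ℤ) < x.2.2) +
    (C.critical P).val.map (fun c => (C.dim c, C.g c, (⊤ : WithTop ℤ)))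

theorem count_standardIntervals [DecidableEq α] (C : CellData F α) (P : Finset (α × α)) (p : ℕ)
    (b : ℤ) (d : WithTop ℤ) :
    ((C.standardIntervals P).count (p, b, d) : ℤ) =
      (∑ c ∈ C.critical P, if C.dim c = p ∧ C.g c = b ∧ d = ⊤ then 1 else 0) +
      ∑ q ∈ P, if C.dim q.2 = p ∧ C.g q.2 = b ∧ (C.g q.1 : WithTop ℤ) = d ∧ (b : WithTop ℤ) < d
        then 1 else 0 := by
  rw [standardIntervals, Multiset.count_add, matchedIntervals, Multiset.filter_map,
    Multiset.count_map, Multiset.count_map, ← Finset.filter_val, ← Finset.filter_val,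
    ← Finset.filter_val, Finset.card_val, Finset.card_val, Finset.filter_filter, add_comm]
  push_cast [Finset.natCast_card_filter]
  congr 1
  · refine Finset.sum_congr rfl fun c _ => if_congr ?_ rfl rfl
    simp only [Prod.mk.injEq]
    tauto
  · refine Finset.sum_congr rfl fun c _ => if_congr ?_ rfl rfl
    simp only [Prod.mk.injEq, Function.comp]
    constructor
    · rintro ⟨h1, rfl, rfl, rfl⟩; exact ⟨rfl, rfl, rfl, h1⟩
    · rintro ⟨rfl, rfl, rfl, h1⟩; exact ⟨h1, rfl, rfl, rfl⟩

/-- The identity holds summand by summand: filtration values are integers, so differences of the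
threshold indicators at `b`, `b - 1` and at `d - 1`, `d` are indicators of equality. -/
theorem IsStandardBasis.isPersistenceIntervals [DecidableEq α] {C : CellData F α}
    {P : Finset (α × α)} {e : α → α →₀ F} (he : C.IsStandardBasis P e) :
    C.IsPersistenceIntervals (C.standardIntervals P) := by
  intro p b d
  rw [count_standardIntervals]
  induction d using WithTop.recTopCoe with
  | top =>
    change _ = C.persistentBetti p b ⊤ - C.persistentBetti p ((b - 1 : ℤ) : WithTop ℤ) ⊤
    rw [he.persistentBetti_eq_sum p le_top, he.persistentBetti_eq_sum p le_top]
    simp only [WithTop.coe_le_coe, not_top_lt, and_false, if_false, Finset.sum_const_zero, add_zero,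
      WithTop.coe_ne_top, false_and, and_true, ← Finset.sum_sub_distrib]
    refine Finset.sum_congr rfl fun c _ => ?_
    split_ifs <;> omega
  | coe d =>
    simp only [multiplicity, WithTop.coe_lt_coe, WithTop.coe_inj, WithTop.coe_ne_top, and_false,
      if_false, Finset.sum_const_zero, zero_add]
    split_ifs with hbd
    · rw [he.persistentBetti_eq_sum p (WithTop.coe_le_coe.2 (by omega : b ≤ d - 1)),
        he.persistentBetti_eq_sum p (WithTop.coe_le_coe.2 (by omega : b ≤ d)),
        he.persistentBetti_eq_sum p (WithTop.coe_le_coe.2 (by omega : b - 1 ≤ d - 1)),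
        he.persistentBetti_eq_sum p (WithTop.coe_le_coe.2 (by omega : b - 1 ≤ d))]
      simp only [add_sub_add_left_eq_sub, ← Finset.sum_sub_distrib, WithTop.coe_le_coe,
        WithTop.coe_lt_coe]
      refine Finset.sum_congr rfl fun q _ => ?_
      split_ifs <;> omega
    · simp [hbd]

end CellData

namespace CellData

universe u v

variable {F : Type u} [Field F] {α : Type v} [DecidableEq α]

/-! ### Standard bases and Morse complexes -/

/-- The basis of the chains of `C` obtained from a basis `e` of the chains of the Morse complex,
the upper cells of the matching, and their boundaries. -/
noncomputable def extendBasis (C : CellData F α) (m : Finset (α × α)) (e : α → α →₀ F) (c : α) :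
    α →₀ F :=
  if c ∈ C.critical m then C.liftMap m (e c)
  else if c ∈ m.image Prod.snd then
    C.boundary (∑ q ∈ m with q.2 = c, Finsupp.single q.1 1)
  else Finsupp.single c 1

section Extend

variable {C : CellData F α} {m P : Finset (α × α)} {e : α → α →₀ F}

theorem extendBasis_critical {c : α} (hc : c ∈ C.critical m) :
    C.extendBasis m e c = C.liftMap m (e c) := if_pos hc

variable (hC : C.IsFilteredComplex) (hm : C.IsMorseMatching m)

include hC hm

theorem extendBasis_fst {q : α × α} (hq : q ∈ m) :
    C.extendBasis m e q.1 = Finsupp.single q.1 1 := by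
  rw [extendBasis, if_neg fun h => (mem_critical.1 h).2.1 q hq rfl, if_neg]
  intro h
  obtain ⟨r, hr, h⟩ := Finset.mem_image.1 h
  exact hm.fst_ne_snd hC hq hr h.symm

theorem extendBasis_snd {q : α × α} (hq : q ∈ m) :
    C.extendBasis m e q.2 = C.boundary (Finsupp.single q.1 1) := by
  rw [extendBasis, if_neg fun h => (mem_critical.1 h).2.2 q hq rfl,
    if_pos (Finset.mem_image_of_mem _ hq)]
  have : m.filter (fun r => r.2 = q.2) = {q} := by
    ext r
    rw [Finset.mem_filter, Finset.mem_singleton]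
    refine ⟨fun h => hm.disjoint r h.1 q hq (Or.inr (Or.inl h.2)), ?_⟩
    rintro rfl
    exact ⟨hq, rfl⟩
  rw [this, Finset.sum_singleton]

theorem sum_cells_eq {V : Type*} [AddCommMonoid V] (f : α → V) :
    ∑ c ∈ C.cells, f c = ∑ c ∈ C.critical m, f c + (∑ q ∈ m, f q.1 + ∑ q ∈ m, f q.2) := by
  have h1 : ∑ q ∈ m, f q.1 = ∑ c ∈ m.image Prod.fst, f c :=
    (Finset.sum_image fun q hq r hr h => hm.disjoint q hq r hr (Or.inl h)).symm
  have h2 : ∑ q ∈ m, f q.2 = ∑ c ∈ m.image Prod.snd, f c :=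
    (Finset.sum_image fun q hq r hr h => hm.disjoint q hq r hr (Or.inr (Or.inl h))).symm
  have hd : Disjoint (m.image Prod.fst) (m.image Prod.snd) := by
    rw [Finset.disjoint_left]
    intro c hc hc'
    obtain ⟨q, hq, rfl⟩ := Finset.mem_image.1 hc
    obtain ⟨r, hr, h⟩ := Finset.mem_image.1 hc'
    exact hm.fst_ne_snd hC hq hr h.symm
  rw [h1, h2, ← Finset.sum_union hd, critical,
    ← Finset.sum_filter_add_sum_filter_not C.cells
      (fun c => c ∉ m.image Prod.fst ∧ c ∉ m.image Prod.snd)]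
  congr 1
  refine Finset.sum_congr ?_ fun _ _ => rfl
  ext c
  rw [Finset.mem_filter, Finset.mem_union, not_and_or, not_not, not_not]
  refine ⟨fun h => h.2, fun h => ⟨?_, h⟩⟩
  rcases h with h | h <;> obtain ⟨q, hq, rfl⟩ := Finset.mem_image.1 h
  · exact (hm.mem q hq).1
  · exact (hm.mem q hq).2

variable (hearly : C.IsEarliest m)

include hearly

theorem liftMap_mem_chains {p : ℕ} {t : WithTop ℤ} {x : α →₀ F}
    (hx : x ∈ (C.morseComplex m).chains p t) : C.liftMap m x ∈ C.chains p t := by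
  rw [mem_chains] at hx
  rw [liftMap, Finsupp.linearCombination_apply]
  refine Submodule.sum_mem _ fun c hc => Submodule.smul_mem _ _ ?_
  obtain ⟨h1, rfl, h3⟩ := hx c (Finsupp.mem_support_iff.1 hc)
  exact C.chains_mono _ h3 (lift_mem_chains hC hm hearly h1)

/-- A relation reads `liftMap x + z + ∂y = 0` with `y`, `z` chains of upper cells. Coordinates at
lower cells force `y = 0`, then those at critical cells force `x = 0`, and `z = 0` remains. -/
theorem linearIndepOn_extendBasis (he : (C.morseComplex m).IsStandardBasis P e) :
    LinearIndepOn F (C.extendBasis m e) (C.cells : Set α) := by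
  rw [linearIndepOn_finset_iff]
  intro f hf
  set x := ∑ c ∈ C.critical m, f c • e c with hx
  set y := ∑ q ∈ m, f q.2 • Finsupp.single q.1 (1 : F) with hy
  set z := ∑ q ∈ m, f q.1 • Finsupp.single q.1 (1 : F) with hz
  have hxc : ∀ v, x v ≠ 0 → v ∈ C.critical m := by
    intro v hv
    rw [hx, Finsupp.finsetSum_apply] at hv
    obtain ⟨c, hc, hne⟩ := Finset.exists_ne_zero_of_sum_ne_zero hv
    exact (mem_chains.1 (he.mem_chains c hc) v (right_ne_zero_of_mul hne)).1
  have hsum : C.liftMap m x + (z + C.boundary y) = 0 := by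
    rw [← hf, sum_cells_eq hC hm, hx, hy, hz]
    simp only [map_sum, map_smul]
    refine congrArg₂ _ ?_ (congrArg₂ _ ?_ ?_)
    · exact Finset.sum_congr rfl fun c hc => by rw [extendBasis_critical hc]
    · exact Finset.sum_congr rfl fun q hq => by rw [extendBasis_fst hC hm hq]
    · exact Finset.sum_congr rfl fun q hq => by rw [extendBasis_snd hC hm hq]
  have hupper : ∀ (k : α × α → F) (v : α),
      (∑ q ∈ m, k q • Finsupp.single q.1 (1 : F)) v ≠ 0 → ∃ q ∈ m, q.1 = v := by
    intro k v hv
    rw [Finsupp.finsetSum_apply] at hv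
    obtain ⟨q, hq, hne⟩ := Finset.exists_ne_zero_of_sum_ne_zero hv
    refine ⟨q, hq, ?_⟩
    by_contra h
    simp [h] at hne
  have hcoord : ∀ (k : α × α → F), ∀ q ∈ m,
      (∑ r ∈ m, k r • Finsupp.single r.1 (1 : F)) q.1 = k q := by
    intro k q hq
    rw [Finsupp.finsetSum_apply, Finset.sum_eq_single q]
    · simp
    · intro r hr hrq
      have : r.1 ≠ q.1 := fun h => hrq (hm.disjoint r hr q hq (Or.inl h))
      simp [this]
    · exact fun h => absurd hq h
  have hy0 : y = 0 := by
    refine eq_zero_of_boundary_snd_eq_zero hC hm (hupper fun q => f q.2) fun q hq => ?_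
    have h1 := DFunLike.congr_fun hsum q.2
    have h2 : z q.2 = 0 := by
      by_contra h
      obtain ⟨r, hr, h⟩ := hupper (fun q => f q.1) _ h
      exact hm.fst_ne_snd hC hr hq h
    simpa [liftMap_apply_snd hC hm hearly hxc hq, h2] using h1
  rw [hy0, map_zero, add_zero] at hsum
  have hx0 : x = 0 := by
    ext t
    by_contra hne
    have ht := hxc t hne
    have h1 := DFunLike.congr_fun hsum t
    have h2 : z t = 0 := by
      by_contra h
      obtain ⟨r, hr, h⟩ := hupper (fun q => f q.1) _ h
      exact (mem_critical.1 ht).2.1 r hr h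
    rw [Finsupp.add_apply, liftMap_apply_critical hC hm hearly hxc ht, h2, add_zero] at h1
    exact hne h1
  rw [hx0, map_zero, zero_add] at hsum
  intro c hc
  by_cases h1 : ∃ q ∈ m, q.1 = c
  · obtain ⟨q, hq, rfl⟩ := h1
    rw [← hcoord (fun q => f q.1) q hq, ← hz, hsum]
    rfl
  by_cases h2 : ∃ q ∈ m, q.2 = c
  · obtain ⟨q, hq, rfl⟩ := h2
    rw [← hcoord (fun q => f q.2) q hq, ← hy, hy0]
    rfl
  push Not at h1 h2
  exact linearIndepOn_finset_iff.1 he.linearIndepOn f hx0 c (mem_critical.2 ⟨hc, h1, h2⟩)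

theorem IsStandardBasis.extendBasis (hmax : C.IsMaximal m)
    (he : (C.morseComplex m).IsStandardBasis P e) :
    C.IsStandardBasis (P ∪ m) (C.extendBasis m e) := by
  have hsupp : ∀ c ∈ C.critical m, ∀ v, e c v ≠ 0 → v ∈ C.critical m := fun c hc v hv =>
    (CellData.mem_chains.1 (he.mem_chains c hc) v hv).1
  have hcell : ∀ c ∈ C.critical m, c ∈ C.cells := fun c hc => (mem_critical.1 hc).1
  have hP : ∀ q ∈ P, q.1 ∈ C.critical m ∧ q.2 ∈ C.critical m := he.pair_mem
  refine ⟨fun c hc => ?_, linearIndepOn_extendBasis hC hm hearly he, fun q hq => ?_,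
    fun q hq r hr h => ?_, fun q hq r hr h => ?_, fun q hq => ?_, fun q hq => ?_, fun q hq => ?_,
    fun c hc h => ?_⟩
  · by_cases h1 : ∃ q ∈ m, q.1 = c
    · obtain ⟨q, hq, rfl⟩ := h1
      rw [extendBasis_fst hC hm hq]
      exact Finsupp.single_mem_supported _ _ ⟨hc, rfl, le_rfl⟩
    by_cases h2 : ∃ q ∈ m, q.2 = c
    · obtain ⟨q, hq, rfl⟩ := h2
      rw [extendBasis_snd hC hm hq]
      refine CellData.mem_chains.2 fun c hc => ?_
      obtain ⟨v, hv, h3, h4⟩ := hC.exists_of_boundary_apply_ne_zero hc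
      obtain rfl : v = q.1 := by
        by_contra h
        exact h3 (Finsupp.single_eq_of_ne h)
      refine ⟨hC.mem_right _ _ h4, ?_, WithTop.coe_le_coe.2 (hmax q hq c h4)⟩
      have h5 := hC.dim_eq _ _ h4
      have h6 := hC.dim_eq _ _ (hm.face q hq)
      omega
    push Not at h1 h2
    have hc' : c ∈ C.critical m := mem_critical.2 ⟨hc, h1, h2⟩
    rw [extendBasis_critical hc']
    exact liftMap_mem_chains hC hm hearly (he.mem_chains c hc')
  · rcases Finset.mem_union.1 hq with hq | hq
    · exact ⟨hcell _ (hP q hq).1, hcell _ (hP q hq).2⟩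
    · exact hm.mem q hq
  · rcases Finset.mem_union.1 hq with hq | hq <;> rcases Finset.mem_union.1 hr with hr | hr
    · exact he.injective q hq r hr h
    · rcases h with h | h
      · exact absurd h.symm ((mem_critical.1 (hP q hq).1).2.1 r hr)
      · exact absurd h.symm ((mem_critical.1 (hP q hq).2).2.2 r hr)
    · rcases h with h | h
      · exact absurd h ((mem_critical.1 (hP r hr).1).2.1 q hq)
      · exact absurd h ((mem_critical.1 (hP r hr).2).2.2 q hq)
    · exact hm.disjoint q hq r hr (h.imp_right Or.inl)
  · rcases Finset.mem_union.1 hq with hq | hq <;> rcases Finset.mem_union.1 hr with hr | hr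
    · exact he.fst_ne_snd q hq r hr h
    · exact absurd h.symm ((mem_critical.1 (hP q hq).1).2.2 r hr)
    · exact absurd h ((mem_critical.1 (hP r hr).2).2.1 q hq)
    · exact hm.fst_ne_snd hC hq hr h
  · rcases Finset.mem_union.1 hq with hq | hq
    · exact he.dim_eq q hq
    · exact hC.dim_eq _ _ (hm.face q hq)
  · rcases Finset.mem_union.1 hq with hq | hq
    · exact he.g_le q hq
    · exact hC.g_le _ _ (hm.face q hq)
  · rcases Finset.mem_union.1 hq with hq | hq
    · obtain ⟨h1, h2⟩ := hP q hq
      rw [extendBasis_critical h1, extendBasis_critical h2,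
        boundary_liftMap hC hm hearly (hsupp _ h1), he.boundary_fst q hq]
    · rw [extendBasis_fst hC hm hq, extendBasis_snd hC hm hq]
  · have h1 : ∀ q ∈ m, q.1 ≠ c := fun q hq => h q (Finset.mem_union_right _ hq)
    by_cases h2 : ∃ q ∈ m, q.2 = c
    · obtain ⟨q, hq, rfl⟩ := h2
      rw [extendBasis_snd hC hm hq, hC.boundary_boundary_apply]
    · push Not at h2
      have hc' : c ∈ C.critical m := mem_critical.2 ⟨hc, h1, h2⟩
      rw [extendBasis_critical hc', boundary_liftMap hC hm hearly (hsupp _ hc'),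
        he.boundary_eq_zero c hc' fun q hq => h q (Finset.mem_union_left _ hq), map_zero]

theorem standardIntervals_union (he : (C.morseComplex m).IsStandardBasis P e) :
    C.standardIntervals (P ∪ m) =
      (C.matchedIntervals m).filter (fun x => (x.2.1 : WithTop ℤ) < x.2.2) +
        (C.morseComplex m).standardIntervals P := by
  have hP : ∀ q ∈ P, q.1 ∈ C.critical m ∧ q.2 ∈ C.critical m := he.pair_mem
  have hd : Disjoint P m := by
    rw [Finset.disjoint_left]
    exact fun q hq hq' => (mem_critical.1 (hP q hq).1).2.1 q hq' rfl
  have h1 : C.matchedIntervals (P ∪ m) = (C.morseComplex m).matchedIntervals P +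
      C.matchedIntervals m := by
    rw [matchedIntervals, ← Finset.disjUnion_eq_union P m hd, Finset.disjUnion_val,
      Multiset.map_add]
    rfl
  have h2 : C.critical (P ∪ m) = (C.morseComplex m).critical P := by
    ext c
    rw [mem_critical, mem_critical]
    change _ ↔ c ∈ C.critical m ∧ _
    rw [mem_critical]
    simp only [Finset.mem_union, or_imp, forall_and]
    tauto
  rw [standardIntervals, standardIntervals, h1, h2, Multiset.filter_add]
  change _ = _ + (_ + Multiset.map (fun c => (C.dim c, C.g c, (⊤ : WithTop ℤ))) _)
  abel

end Extend

/-- `S` is the multiset of intervals of a standard basis of `C`. -/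
def HasStandardIntervals (C : CellData F α) (S : Multiset (ℕ × ℤ × WithTop ℤ)) : Prop :=
  ∃ P e, C.IsStandardBasis P e ∧ S = C.standardIntervals P

theorem HasStandardIntervals.isPersistenceIntervals {C : CellData F α}
    {S : Multiset (ℕ × ℤ × WithTop ℤ)} (h : C.HasStandardIntervals S) :
    C.IsPersistenceIntervals S := by
  obtain ⟨P, e, he, rfl⟩ := h
  exact he.isPersistenceIntervals

/-- One backward step of the construction. The filter discards intervals of length zero: all of them
for a compatible matching, none during the algorithm. -/
theorem HasStandardIntervals.of_morseComplex {C : CellData F α} {m : Finset (α × α)}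
    (hC : C.IsFilteredComplex) (hm : C.IsMorseMatching m) (hearly : C.IsEarliest m)
    (hmax : C.IsMaximal m) {S : Multiset (ℕ × ℤ × WithTop ℤ)}
    (h : (C.morseComplex m).HasStandardIntervals S) :
    C.HasStandardIntervals
      ((C.matchedIntervals m).filter (fun x => (x.2.1 : WithTop ℤ) < x.2.2) + S) := by
  obtain ⟨P, e, he, rfl⟩ := h
  exact ⟨P ∪ m, C.extendBasis m e, he.extendBasis hC hm hearly hmax,
    (standardIntervals_union hC hm hearly he).symm⟩

theorem hasStandardIntervals_infiniteIntervals {C : CellData F α} (h : ∀ A b, C.κ A b = 0) :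
    C.HasStandardIntervals C.infiniteIntervals := by
  have h0 : ∀ x, C.boundary x = 0 := by
    intro x
    simp [boundary, h, Finsupp.linearCombination_apply]
  refine ⟨∅, fun c => Finsupp.single c 1, ⟨fun c hc => ?_, ?_, ?_, ?_, ?_, ?_, ?_, ?_,
    fun c _ _ => h0 _⟩, ?_⟩
  · exact Finsupp.single_mem_supported _ _ ⟨hc, rfl, le_rfl⟩
  · exact (Finsupp.linearIndependent_single_one F α).linearIndepOn _
  · simp
  · simp
  · simp
  · simp
  · simp
  · simp
  · have hcrit : C.critical ∅ = C.cells := by ext c; simp [mem_critical]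
    simp [standardIntervals, matchedIntervals, hcrit, infiniteIntervals]

end CellData

namespace CellData

universe u v

variable {F : Type u} [Field F] {α : Type v} [DecidableEq α]

/-! ### Matchings on sublevel complexes -/

section Sublevel

variable {C : CellData F α} {m : Finset (α × α)}

theorem sublevel_κ_ne_zero {i : ℤ} {A b : α} :
    (C.sublevel i).κ A b ≠ 0 ↔ (C.g A ≤ i ∧ C.g b ≤ i) ∧ C.κ A b ≠ 0 := by
  simp [sublevel, and_assoc]

theorem IsFilteredComplex.sublevel (hC : C.IsFilteredComplex) (i : ℤ) :
    (C.sublevel i).IsFilteredComplex := by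
  refine ⟨fun A b h => ?_, fun A b h => ?_, fun A b h => ?_, fun A b h => ?_, fun A c => ?_⟩
  · obtain ⟨h1, h2⟩ := sublevel_κ_ne_zero.1 h
    exact Finset.mem_filter.2 ⟨hC.mem_left _ _ h2, h1.1⟩
  · obtain ⟨h1, h2⟩ := sublevel_κ_ne_zero.1 h
    exact Finset.mem_filter.2 ⟨hC.mem_right _ _ h2, h1.2⟩
  · exact hC.dim_eq _ _ (sublevel_κ_ne_zero.1 h).2
  · exact hC.g_le _ _ (sublevel_κ_ne_zero.1 h).2
  · by_cases h : C.g A ≤ i ∧ C.g c ≤ i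
    · rw [← hC.boundary_boundary A c]
      change ∑ b ∈ C.cells.filter (fun c => C.g c ≤ i), _ = _
      rw [Finset.sum_filter]
      refine Finset.sum_congr rfl fun b _ => ?_
      split_ifs with hb
      · simp [CellData.sublevel, h, hb]
      · by_contra hne
        exact hb ((hC.g_le A b (left_ne_zero_of_mul (Ne.symm hne))).trans h.1)
    · refine Finset.sum_eq_zero fun b _ => ?_
      by_contra hne
      exact h ⟨(sublevel_κ_ne_zero.1 (left_ne_zero_of_mul hne)).1.1,
        (sublevel_κ_ne_zero.1 (right_ne_zero_of_mul hne)).1.2⟩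

/-- This makes vitality effective: when a vital strategy matches nothing, no admissible incidence is
left. -/
theorem isMorseMatching_singleton (hC : C.IsFilteredComplex) {A b : α} (h : C.κ A b ≠ 0) :
    C.IsMorseMatching {(A, b)} := by
  have hd := hC.dim_eq A b h
  refine ⟨?_, ?_, ?_, fun c hc => ?_⟩
  · simp [hC.mem_left A b h, hC.mem_right A b h]
  · simp [h]
  · simp
  · let ρ : α → ℕ := fun c =>
      if c = b then 4 * C.dim b + 2 else if c = A then 4 * C.dim b + 1 else 4 * C.dim c
    have hAb : A ≠ b := by rintro rfl; omega
    have hρ : ∀ u v, C.MorseEdge {(A, b)} u v → ρ v < ρ u := by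
      rintro u v (⟨h1, h2⟩ | h1)
      · have h3 := hC.dim_eq u v h1
        rw [Finset.mem_singleton, Prod.mk.injEq] at h2
        simp only [ρ]
        split_ifs <;> subst_vars <;> first | omega | exact absurd ⟨rfl, rfl⟩ h2
      · rw [Finset.mem_singleton, Prod.mk.injEq] at h1
        obtain ⟨rfl, rfl⟩ := h1
        simp [ρ, hAb]
    have hlt : ∀ u v, Relation.TransGen (C.MorseEdge {(A, b)}) u v → ρ v < ρ u := by
      intro u v huv
      induction huv with
      | single h => exact hρ _ _ h
      | tail _ h ih => exact (hρ _ _ h).trans ih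
    exact lt_irrefl _ (hlt c c hc)

/-- Paths never leave the sublevel, where acyclicity is given; above it nothing is matched, so every
edge starting there lowers the dimension. -/
theorem IsMorseMatching.of_sublevel (hC : C.IsFilteredComplex) {i : ℤ}
    (hm : (C.sublevel i).IsMorseMatching m) : C.IsMorseMatching m := by
  have hmi : ∀ q ∈ m, (q.1 ∈ C.cells ∧ C.g q.1 ≤ i) ∧ (q.2 ∈ C.cells ∧ C.g q.2 ≤ i) := by
    intro q hq
    exact ⟨Finset.mem_filter.1 (hm.mem q hq).1, Finset.mem_filter.1 (hm.mem q hq).2⟩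
  have hlow : ∀ u v, C.MorseEdge m u v → C.g u ≤ i →
      C.g v ≤ i ∧ (C.sublevel i).MorseEdge m u v := by
    rintro u v (⟨h1, h2⟩ | h1) hu
    · have hv := (hC.g_le u v h1).trans hu
      exact ⟨hv, Or.inl ⟨sublevel_κ_ne_zero.2 ⟨⟨hu, hv⟩, h1⟩, h2⟩⟩
    · exact ⟨(hmi _ h1).1.2, Or.inr h1⟩
  refine ⟨fun q hq => ⟨(hmi q hq).1.1, (hmi q hq).2.1⟩,
    fun q hq => (sublevel_κ_ne_zero.1 (hm.face q hq)).2, hm.disjoint, fun c hc => ?_⟩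
  by_cases hci : C.g c ≤ i
  · have key : ∀ v, Relation.TransGen (C.MorseEdge m) c v →
        C.g v ≤ i ∧ Relation.TransGen ((C.sublevel i).MorseEdge m) c v := by
      intro v hv
      induction hv with
      | single h => exact ⟨(hlow _ _ h hci).1, .single (hlow _ _ h hci).2⟩
      | tail _ h ih => exact ⟨(hlow _ _ h ih.1).1, ih.2.tail (hlow _ _ h ih.1).2⟩
    exact hm.acyclic c (key c hc).2
  · have hhigh : ∀ u v, C.MorseEdge m u v → ¬ C.g u ≤ i → C.dim v < C.dim u := by
      rintro u v (⟨h1, -⟩ | h1) hu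
      · have := hC.dim_eq u v h1
        omega
      · exact absurd (hmi _ h1).2.2 hu
    have key : ∀ v, Relation.TransGen (C.MorseEdge m) c v → C.g v ≤ i ∨ C.dim v < C.dim c := by
      intro v hv
      induction hv with
      | single h => exact Or.inr (hhigh _ _ h hci)
      | @tail w v _ h ih =>
        by_cases hw : C.g w ≤ i
        · exact Or.inl (hlow _ _ h hw).1
        · exact Or.inr ((hhigh _ _ h hw).trans (ih.resolve_left hw))
    rcases key c hc with h | h
    · exact hci h
    · exact lt_irrefl _ h

theorem IsMaximal.of_sublevel (hC : C.IsFilteredComplex) {i : ℤ}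
    (hm : (C.sublevel i).IsMorseMatching m) (h : (C.sublevel i).IsMaximal m) :
    C.IsMaximal m := by
  intro q hq b hb
  have hA : C.g q.1 ≤ i := (Finset.mem_filter.1 (hm.mem q hq).1).2
  exact h q hq b (sublevel_κ_ne_zero.2 ⟨⟨hA, (hC.g_le _ _ hb).trans hA⟩, hb⟩)

theorem card_morseComplex_lt (hm : C.IsMorseMatching m) (hne : m.Nonempty) :
    (C.morseComplex m).cells.card < C.cells.card := by
  obtain ⟨q, hq⟩ := hne
  refine Finset.card_lt_card ⟨Finset.filter_subset _ _, fun hsub => ?_⟩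
  exact (mem_critical.1 (hsub (hm.mem q hq).1)).2.1 q hq rfl

end Sublevel

/-! ### The iterated Morse complex -/

section Iterated

variable {C : CellData F α} {m : Finset (α × α)}

theorem IsCompatible.isEarliest (hC : C.IsFilteredComplex) (h : C.IsCompatible m) :
    C.IsEarliest m := fun q hq c hc => (h q hq).trans_le (hC.g_le c _ hc)

theorem IsCompatible.isMaximal (hC : C.IsFilteredComplex) (h : C.IsCompatible m) :
    C.IsMaximal m := fun q hq b hb => (hC.g_le _ b hb).trans_eq (h q hq)

theorem IsCompatible.filter_matchedIntervals (h : C.IsCompatible m) :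
    (C.matchedIntervals m).filter (fun x => (x.2.1 : WithTop ℤ) < x.2.2) = 0 := by
  rw [Multiset.filter_eq_nil]
  intro x hx
  obtain ⟨q, hq, rfl⟩ := Multiset.mem_map.1 hx
  simp [h q hq]

variable {σ : CellData F α → Finset (α × α)} (hσ : IsVitalCompatibleStrategy σ)

include hσ

theorem IsVitalCompatibleStrategy.isFilteredComplex (hC : C.IsFilteredComplex) :
    (C.morseComplex (σ C)).IsFilteredComplex :=
  isFilteredComplex_morseComplex hC (hσ.isMorseMatching C hC) ((hσ.isCompatible C hC).isEarliest hC)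

theorem IsVitalCompatibleStrategy.exists_isIteratedMorseComplex (hC : C.IsFilteredComplex) :
    ∃ D, IsIteratedMorseComplex σ C D := by
  induction hn : C.cells.card using Nat.strong_induction_on generalizing C with
  | _ n ih =>
    have hm := hσ.isMorseMatching C hC
    rcases (σ C).eq_empty_or_nonempty with h0 | h0
    · refine ⟨C, ⟨0, rfl⟩, ?_⟩
      change C.morseComplex (σ C) = C
      rw [h0] at hm ⊢
      exact morseComplex_empty hC hm
    · obtain ⟨D, ⟨k, hk⟩, hD⟩ := ih _ (hn ▸ card_morseComplex_lt hm h0)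
        (hσ.isFilteredComplex hC) rfl
      exact ⟨D, ⟨k + 1, hk⟩, hD⟩

theorem IsVitalCompatibleStrategy.iterate (n : ℕ) (hC : C.IsFilteredComplex) :
    ((fun D : CellData F α => D.morseComplex (σ D))^[n] C).IsFilteredComplex ∧
      ∀ S, ((fun D : CellData F α => D.morseComplex (σ D))^[n] C).HasStandardIntervals S →
        C.HasStandardIntervals S := by
  induction n generalizing C with
  | zero => exact ⟨hC, fun _ h => h⟩
  | succ n ih =>
    obtain ⟨h1, h2⟩ := ih (hσ.isFilteredComplex hC)
    refine ⟨h1, fun S hS => ?_⟩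
    have hc := hσ.isCompatible C hC
    have h3 := (h2 S hS).of_morseComplex hC (hσ.isMorseMatching C hC) (hc.isEarliest hC)
      (hc.isMaximal hC)
    rwa [hc.filter_matchedIntervals, zero_add] at h3

/-- An incidence between equal values would be a compatible matching by itself, so the strategy
would remove cells and the complex would not be fixed. -/
theorem IsVitalCompatibleStrategy.g_lt_of_isFixedPt (hC : C.IsFilteredComplex)
    (hfix : Function.IsFixedPt (fun D : CellData F α => D.morseComplex (σ D)) C) {A b : α}
    (h : C.κ A b ≠ 0) : C.g b < C.g A := by
  refine lt_of_le_of_ne (hC.g_le A b h) fun hg => ?_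
  have hne := hσ.vital C hC ⟨{(A, b)}, isMorseMatching_singleton hC h, by simp [IsCompatible, hg],
    Finset.singleton_nonempty _⟩
  have hlt := card_morseComplex_lt (hσ.isMorseMatching C hC) hne
  have heq : C.morseComplex (σ C) = C := hfix
  rw [heq] at hlt
  exact lt_irrefl _ hlt

end Iterated

/-! ### The algorithm -/

section Algorithm

/-- The loop invariant: incidences strictly decrease the filtration value, and the nonzero
boundaries are those of cells at the levels in `L`. -/
structure IsReduced (C : CellData F α) (L : List ℤ) : Prop where
  isFilteredComplex : C.IsFilteredComplex
  g_lt : ∀ A b, C.κ A b ≠ 0 → C.g b < C.g A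
  g_mem : ∀ A b, C.κ A b ≠ 0 → C.g A ∈ L

variable {C : CellData F α} {τ : CellData F α → ℤ → Finset (α × α)}
  (hτ : IsVitalMaximalStrategy τ) {i : ℤ} {L : List ℤ} (hL : ∀ j ∈ L, i < j)

include hτ

theorem IsVitalMaximalStrategy.isMorseMatching' (hC : C.IsFilteredComplex) :
    C.IsMorseMatching (τ C i) :=
  (hτ.isMorseMatching C hC i).of_sublevel hC

theorem IsVitalMaximalStrategy.isMaximal' (hC : C.IsFilteredComplex) : C.IsMaximal (τ C i) :=
  (hτ.isMaximal C hC i).of_sublevel hC (hτ.isMorseMatching C hC i)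

include hL

/-- Matched cells have value at most `i`, whereas by the invariant any cell with a face has value at
least `i`. -/
theorem IsReduced.isEarliest (hC : C.IsReduced (i :: L)) : C.IsEarliest (τ C i) := by
  intro q hq c hc
  have h1 : C.g q.1 ≤ i :=
    (Finset.mem_filter.1 ((hτ.isMorseMatching C hC.isFilteredComplex i).mem q hq).1).2
  rcases List.mem_cons.1 (hC.g_mem _ _ hc) with h2 | h2
  · omega
  · have := hL _ h2
    omega

theorem IsReduced.morseComplex (hC : C.IsReduced (i :: L)) :
    (C.morseComplex (τ C i)).IsReduced (i :: L) := by
  have hm : C.IsMorseMatching (τ C i) := hτ.isMorseMatching' hC.isFilteredComplex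
  have he := hC.isEarliest hτ hL
  refine ⟨isFilteredComplex_morseComplex hC.isFilteredComplex hm he, fun A b h => ?_,
    fun A b h => ?_⟩
  · obtain ⟨⟨v, h1, h2⟩, -⟩ := morseComplex_κ_ne_zero hC.isFilteredComplex hm he h
    exact (hC.g_lt v b h1).trans_le h2
  · obtain ⟨-, c, hc⟩ := morseComplex_κ_ne_zero hC.isFilteredComplex hm he h
    exact hC.g_mem A c hc

theorem IsReduced.filter_matchedIntervals (hC : C.IsReduced (i :: L)) :
    (C.matchedIntervals (τ C i)).filter (fun x => (x.2.1 : WithTop ℤ) < x.2.2) =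
      C.matchedIntervals (τ C i) := by
  rw [Multiset.filter_eq_self]
  intro x hx
  obtain ⟨q, hq, rfl⟩ := Multiset.mem_map.1 hx
  have hm : C.IsMorseMatching (τ C i) := hτ.isMorseMatching' hC.isFilteredComplex
  exact WithTop.coe_lt_coe.2 (hC.g_lt _ _ (hm.face q hq))

theorem IsReduced.exists_whileLoop (hC : C.IsReduced (i :: L))
    (S : Multiset (ℕ × ℤ × WithTop ℤ)) : ∃ C' S', WhileLoop τ i C S C' S' := by
  induction hn : C.cells.card using Nat.strong_induction_on generalizing C S with
  | _ n ih =>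
    by_cases h0 : τ C i = ∅
    · exact ⟨C, S, .done C S h0⟩
    · have hm : C.IsMorseMatching (τ C i) := hτ.isMorseMatching' hC.isFilteredComplex
      obtain ⟨C', S', h⟩ := ih _ (hn ▸ card_morseComplex_lt hm (Finset.nonempty_iff_ne_empty.2 h0))
        (hC.morseComplex hτ hL) (S + C.matchedIntervals (τ C i)) rfl
      exact ⟨C', S', .step C C' S S' h0 h⟩

/-- Stopping at level `i` means that no cell there has a nonzero boundary, so `i` leaves the list.
`T` is what the loop adds to `S`; it completes the intervals of the result to those of the input. -/
theorem WhileLoop.isReduced {S S' : Multiset (ℕ × ℤ × WithTop ℤ)} {C' : CellData F α}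
    (h : WhileLoop τ i C S C' S') (hC : C.IsReduced (i :: L)) :
    C'.IsReduced L ∧ ∃ T, S' = S + T ∧
      ∀ U, C'.HasStandardIntervals U → C.HasStandardIntervals (T + U) := by
  induction h with
  | done C S h0 =>
    refine ⟨⟨hC.isFilteredComplex, hC.g_lt, fun A b h => ?_⟩, 0, (add_zero S).symm,
      fun U hU => by rwa [zero_add]⟩
    rcases List.mem_cons.1 (hC.g_mem A b h) with h1 | h1
    · have hA : C.g A ≤ i := h1.le
      have hne := hτ.vital C hC.isFilteredComplex i ⟨{(A, b)},
        isMorseMatching_singleton (hC.isFilteredComplex.sublevel i) (sublevel_κ_ne_zero.2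
          ⟨⟨hA, (hC.isFilteredComplex.g_le A b h).trans hA⟩, h⟩), Finset.singleton_nonempty _⟩
      rw [h0] at hne
      exact absurd hne Finset.not_nonempty_empty
    · exact h1
  | step C C' S S' h0 hrest ih =>
    obtain ⟨h1, T, rfl, h2⟩ := ih (hC.morseComplex hτ hL)
    refine ⟨h1, C.matchedIntervals (τ C i) + T, add_assoc _ _ _, fun U hU => ?_⟩
    have h3 := (h2 U hU).of_morseComplex hC.isFilteredComplex
      (hτ.isMorseMatching' hC.isFilteredComplex) (hC.isEarliest hτ hL)
      (hτ.isMaximal' hC.isFilteredComplex)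
    rwa [hC.filter_matchedIntervals hτ hL, ← add_assoc] at h3

omit hL

theorem IsReduced.exists_forLoop (hC : C.IsReduced L) (hsort : L.Pairwise (· < ·))
    (S : Multiset (ℕ × ℤ × WithTop ℤ)) : ∃ C' S', ForLoop τ L C S C' S' := by
  induction L generalizing C S with
  | nil => exact ⟨C, S, .nil C S⟩
  | cons i L ih =>
    obtain ⟨hi, hsort⟩ := List.pairwise_cons.1 hsort
    obtain ⟨C', S', h1⟩ := hC.exists_whileLoop hτ hi S
    obtain ⟨C'', S'', h2⟩ := ih (h1.isReduced hτ hi hC).1 hsort S'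
    exact ⟨C'', S'', .cons i L C C' C'' S S' S'' h1 h2⟩

theorem ForLoop.isReduced {S S' : Multiset (ℕ × ℤ × WithTop ℤ)} {C' : CellData F α}
    (h : ForLoop τ L C S C' S') (hC : C.IsReduced L) (hsort : L.Pairwise (· < ·)) :
    C'.IsReduced [] ∧ ∃ T, S' = S + T ∧
      ∀ U, C'.HasStandardIntervals U → C.HasStandardIntervals (T + U) := by
  induction h with
  | nil C S => exact ⟨hC, 0, (add_zero S).symm, fun U hU => by rwa [zero_add]⟩
  | cons i L C C' C'' S S' S'' hi _ ih =>
    obtain ⟨hlt, hsort⟩ := List.pairwise_cons.1 hsort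
    obtain ⟨h1, T, rfl, h2⟩ := hi.isReduced hτ hlt hC
    obtain ⟨h3, T', rfl, h4⟩ := ih h1 hsort
    refine ⟨h3, T + T', add_assoc _ _ _, fun U hU => ?_⟩
    rw [add_assoc]
    exact h2 _ (h4 U hU)

omit hτ

/-- A cell of the lowest level has no face, since the face would be strictly lower. This is why the
first level can be skipped. -/
theorem isReduced_levels_tail (hC : C.IsFilteredComplex)
    (hlt : ∀ A b, C.κ A b ≠ 0 → C.g b < C.g A) : C.IsReduced C.levels.tail := by
  refine ⟨hC, hlt, fun A b h => ?_⟩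
  have hmem : ∀ c ∈ C.cells, C.g c ∈ C.levels := fun c hc =>
    (Finset.mem_sort _).2 (Finset.mem_image_of_mem _ hc)
  have hA := hmem A (hC.mem_left A b h)
  have hb := hmem b (hC.mem_right A b h)
  have hs : C.levels.Pairwise (· < ·) := (Finset.sortedLT_sort (C.cells.image C.g)).pairwise
  revert hA hb hs
  cases C.levels with
  | nil => simp
  | cons l L =>
    intro hA hb hs
    have hg := hlt A b h
    rcases List.mem_cons.1 hA with h1 | h1
    · rcases List.mem_cons.1 hb with h2 | h2
      · omega
      · have := (List.pairwise_cons.1 hs).1 _ h2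
        omega
    · exact h1

end Algorithm

end CellData

/-! ### Assembly: fixed point, termination and correctness -/

theorem mainTheorem3 {F : Type*} [Field F] {α : Type*} [DecidableEq α]
    (K : CellData F α) (hK : K.IsFilteredComplex)
    (σ : CellData F α → Finset (α × α)) (hσ : CellData.IsVitalCompatibleStrategy σ)
    (τ : CellData F α → ℤ → Finset (α × α)) (hτ : CellData.IsVitalMaximalStrategy τ) :
    (∃ C, CellData.IsIteratedMorseComplex σ K C) ∧
    ∀ C, CellData.IsIteratedMorseComplex σ K C →
      (∃ S, CellData.Returns τ C S) ∧
      ∀ S, CellData.Returns τ C S → K.IsPersistenceIntervals S := by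
  refine ⟨hσ.exists_isIteratedMorseComplex hK, ?_⟩
  rintro C ⟨⟨n, hn⟩, hfix⟩
  obtain ⟨hC, hint⟩ := hσ.iterate n hK
  rw [← hn] at hC hint
  have hred := CellData.isReduced_levels_tail hC fun _ _ => hσ.g_lt_of_isFixedPt hC hfix
  have hsort : C.levels.tail.Pairwise (· < ·) :=
    (Finset.sortedLT_sort (C.cells.image C.g)).pairwise.tail
  constructor
  · obtain ⟨C', S', h⟩ := hred.exists_forLoop hτ hsort 0
    exact ⟨_, C', S', h, rfl⟩
  · rintro S ⟨C', S', h, rfl⟩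
    obtain ⟨hC', T, rfl, hT⟩ := h.isReduced hτ hred hsort
    -- The invariant with no level left says that the final boundary operator is zero.
    have h0 : ∀ A b, C'.κ A b = 0 := by
      intro A b
      by_contra hne
      exact absurd (hC'.g_mem A b hne) List.not_mem_nil
    rw [zero_add]
    exact (hint _ (hT _ (CellData.hasStandardIntervals_infiniteIntervals
      h0))).isPersistenceIntervals
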